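/- Let $\Xi\subset\mathbb{R}^r$ be convex with nonempty interior, let $f:\mathbb{R}^n\times\Xi\to\mathbb{R}$ and $g=(g_1,\dots,g_m):\mathbb{R}^n\times\Xi\to\mathbb{R}^m$ be twice continuously differentiable in $(x,\xi)$, and consider for $\xi\in\Xi$ the problem $$\min_{x\in\mathbb{R}^n} f(x,\xi)\quad\text{subject to}\quad g(x,\xi)\le 0 .$$ Let $\mathcal{X}(\xi)=\{x: g(x,\xi)\le 0\}$, let $\mathbf{I}_x^\xi=\{i: g_i(x,\xi)=0\}$ be the set of active constraints at $x\in\mathcal X(\xi)$, and let $L(x,\mu,\xi)=f(x,\xi)+\mu^\top g(x,\xi)$. A pair $(x,\mu)\in\mathcal{X}(\xi)\times\mathbb{R}^m_{\ge0}$ is a KKT point for $\xi$ if $\nabla_xL(x,\mu,\xi)=0$ and $\mu_i=0$ whenever $g_i(x,\xi)<0$. Norms are Euclidean norms and the induced operator norms. Assume: 1. $\mathcal{X}(\xi)\neq\emptyset$ for every $\xi\in\Xi$. 2. There are $\alpha>0$, $\beta\ge 0$ and $\ell_1,\dots,\ell_m\ge 0$ such that for every $\xi\in\Xi$ the function $f(\cdot,\xi)$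 is $\alpha$-strongly convex with $\beta$-Lipschitz gradient, and each $g_i(\cdot,\xi)$ is convex with $\ell_i$-Lipschitz gradient. 3. There is $\omega>0$ such that $\omega^2\mathbb{I}\preceq \nabla_xg_{\mathbf{I}_x^\xi}(x,\xi)\,\nabla_xg_{\mathbf{I}_x^\xi}(x,\xi)^\top$ for all $\xi\in\Xi$ and all $x\in\mathcal{X}(\xi)$ with $\mathbf{I}_x^\xi\ne\emptyset$, where $\nabla_xg_{\mathbf{I}}$ is the Jacobian in $x$ of $(g_i)_{i\in\mathbf{I}}$. 4. There are $\zeta_1,\dots,\zeta_m>0$ such that for every $\xi\in\Xi$ every KKT point $(x,\mu)$ for $\xi$ satisfies $\mu_i\le\zeta_i$ for all $i$. Then for every $\xi\in\Xi$ the problem has exactly one minimizer $x^\star(\xi)$, and there is exactly one $\mu^\star(\xi)$ for which $(x^\star(\xi),\mu^\star(\xi))$ is a KKT point. Moreover, put $$\bar L^\star=\sup_{\xi\in\Xi}\bigl\|\nabla^2_{\xi x}L(x^\star(\xi),\mu^\star(\xi),\xi)\bigr\|,\qquad \bar G^\star=\sup_{\xi\in\Xi}\bigl\|\nabla_\xi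 g_{\mathbf{I}^\star(\xi)}(x^\star(\xi),\xi)\bigr\|,\qquad \mathbf{I}^\star(\xi)=\mathbf{I}^\xi_{x^\star(\xi)},$$ where $\nabla^2_{\xi x}L=\nabla_\xi(\nabla_xL)$ is taken with $x,\mu$ fixed, and the second norm is $0$ when $\mathbf{I}^\star(\xi)=\emptyset$. If both suprema are finite, then $x^\star:\Xi\to\mathbb{R}^n$ and $\mu^\star:\Xi\to\mathbb{R}^m$ are Lipschitz continuous on $\Xi$ with respective Lipschitz constants $$\ell_{x^\star}=\sqrt{\frac{\beta+\sum_i\zeta_i\ell_i}{\alpha}}\left(\frac{\bar L^\star}{\alpha}+\frac{\bar G^\star}{\omega}\right),\qquad \ell_{\mu^\star}=\frac{(\beta+\sum_i\zeta_i\ell_i)^{3/2}}{\alpha^{1/2}\,\omega}\left(\frac{\bar L^\star}{\alpha}+\frac{\bar G^\star}{\omega}\right).$$ -/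

import Mathlib

open Set
open scoped NNReal

noncomputable section

/-- `ℝⁿ` with the Euclidean inner product and norm. -/
abbrev Euc (n : ℕ) : Type := EuclideanSpace ℝ (Fin n)

namespace ParamProgram

/-! The program: minimize `f x ξ` over `x ∈ ℝⁿ` subject to `g x ξ ≤ 0` (componentwise in `ℝᵐ`),
with a parameter `ξ ∈ ℝʳ`. -/

/-- The feasible set at the parameter `ξ`. -/
def feasible {n m r : ℕ} (g : Euc n → Euc r → Euc m) (ξ : Euc r) : Set (Euc n) :=
  {x | ∀ i, g x ξ i ≤ 0}

/-- The type of indices of the constraints active at `x` for the parameter `ξ`. -/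
abbrev Active {n m r : ℕ} (g : Euc n → Euc r → Euc m) (x : Euc n) (ξ : Euc r) : Type :=
  {i : Fin m // g x ξ i = 0}

/-- The Lagrangian `f(x, ξ) + μᵀ g(x, ξ)`. -/
def lagrangian {n m r : ℕ} (f : Euc n → Euc r → ℝ) (g : Euc n → Euc r → Euc m)
    (x : Euc n) (μ : Euc m) (ξ : Euc r) : ℝ :=
  f x ξ + ∑ i, μ i * g x ξ i

/-- The Karush-Kuhn-Tucker conditions at `(x, μ)` for the parameter `ξ`. -/
structure IsKKT {n m r : ℕ} (f : Euc n → Euc r → ℝ) (g : Euc n → Euc r → Euc m)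
    (ξ : Euc r) (x : Euc n) (μ : Euc m) : Prop where
  feasible : x ∈ feasible g ξ
  nonneg : ∀ i, 0 ≤ μ i
  stationary : gradient (fun y => lagrangian f g y μ ξ) x = 0
  slack : ∀ i, g x ξ i < 0 → μ i = 0

/-- The (set-valued) primal solution map: the global minimizers at the parameter `ξ`. -/
def primalSolutions {n m r : ℕ} (f : Euc n → Euc r → ℝ) (g : Euc n → Euc r → Euc m)
    (ξ : Euc r) : Set (Euc n) :=
  {x | x ∈ feasible g ξ ∧ IsMinOn (fun y => f y ξ) (feasible g ξ) x}

/-- The (set-valued) dual solution map: the multipliers which, together with some primal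
solution, satisfy the KKT conditions at the parameter `ξ`. -/
def dualSolutions {n m r : ℕ} (f : Euc n → Euc r → ℝ) (g : Euc n → Euc r → Euc m)
    (ξ : Euc r) : Set (Euc m) :=
  {μ | ∃ x ∈ primalSolutions f g ξ, IsKKT f g ξ x μ}

/-- The Jacobian in `x` of the constraints active at `(x, ξ)`; its rows are their gradients. -/
def activeJacobian {n m r : ℕ} (g : Euc n → Euc r → Euc m) (x : Euc n) (ξ : Euc r) :
    Matrix (Active g x ξ) (Fin n) ℝ :=
  Matrix.of fun i j => gradient (fun y => g y ξ i.1) x j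

/-- Uniform LICQ with constant `ω`: `ω² 𝕀 ⪯ J Jᵀ` for the active Jacobian `J` at every feasible
point with at least one active constraint, for every parameter in `Ξ`. -/
def UniformLICQ {n m r : ℕ} (g : Euc n → Euc r → Euc m) (Ξ : Set (Euc r)) (ω : ℝ) : Prop :=
  ∀ ξ ∈ Ξ, ∀ x ∈ feasible g ξ, Nonempty (Active g x ξ) →
    (activeJacobian g x ξ * (activeJacobian g x ξ).transpose
      - (ω ^ 2) • (1 : Matrix (Active g x ξ) (Active g x ξ) ℝ)).PosSemidef

/-- The mixed second derivative `∇²_{ξx} L(x, μ, ξ)`, i.e. the derivative in `ξ` (on `Ξ`) of the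
gradient in `x` of the Lagrangian, as a linear map `ℝʳ → ℝⁿ`. -/
def mixedHessian {n m r : ℕ} (f : Euc n → Euc r → ℝ) (g : Euc n → Euc r → Euc m)
    (Ξ : Set (Euc r)) (x : Euc n) (μ : Euc m) (ξ : Euc r) : Euc r →L[ℝ] Euc n :=
  fderivWithin ℝ (fun η => gradient (fun y => lagrangian f g y μ η) x) Ξ ξ

/-- The derivative in `ξ` (on `Ξ`) of the constraints active at `(x, ξ)`, as a linear map into
the Euclidean space indexed by the active constraints (the zero map if there are none). -/
def activeParamDeriv {n m r : ℕ} (g : Euc n → Euc r → Euc m)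
    (Ξ : Set (Euc r)) (x : Euc n) (ξ : Euc r) :
    Euc r →L[ℝ] EuclideanSpace ℝ (Active g x ξ) :=
  fderivWithin ℝ (fun η => WithLp.toLp 2 fun i : Active g x ξ => g x η i.1) Ξ ξ

end ParamProgram

end

/-! The solution maps need not be differentiable, because the active set may change with `ξ`. Still,
their pointwise growth rate at each `ξ₀` can be bounded by linearising the KKT system at `ξ₀`. Along
a segment of the convex set `Ξ`, a continuous map with growth rate at most `C` everywhere is
`C`-Lipschitz (`norm_image_sub_le_of_eventually_le`).

Both solution maps are first shown to be continuous: the primal one by strong convexity of the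
Lagrangian (`sq_norm_sub_le`), the dual one by LICQ. Hence, for `ξ` near `ξ₀`, the set `A` of
constraints active at `ξ` lies inside the active set at `ξ₀` and contains every constraint whose
multiplier at `ξ₀` is positive. So the multiplier increment `ν` is supported on `A`, and each `g_i`
with `i ∈ A` vanishes at both solutions. Up to small errors, the increments then solve the saddle
point system `H x + T ν = a`, `T* x = b`, where `H` is the Hessian of the Lagrangian and `T`
combines the gradients of the constraints in `A`, all taken at `ξ₀`.

`saddle_system_bound` gives the constants. If `H q = a` and `T* d = b`, then `x - q` and `x - d` are
orthogonal for the inner product of `H`, so `x` lies on a Thales sphere and its energy norm is at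
most that of `q` plus that of `d`. The factor `√(B / α)`, with `B = β + ∑ ζ_i ℓ_i`, is the cost of
passing between energy and Euclidean norms. -/

open Filter Topology InnerProductSpace

/-! ### Strong convexity and Hessians -/

/-- First-order lower bound for differentiable strongly convex functions. -/
theorem StrongConvexOn.lower_bound_of_hasGradientAt {E : Type*} [NormedAddCommGroup E]
    [InnerProductSpace ℝ E] [CompleteSpace E] {φ : E → ℝ} {α : ℝ}
    (h : StrongConvexOn univ α φ) {x v : E} (hv : HasGradientAt φ v x) (y : E) :
    φ x + ⟪v, y - x⟫_ℝ + α / 2 * ‖y - x‖ ^ 2 ≤ φ y := by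
  have hd : HasDerivAt (fun t : ℝ => φ (x + t • (y - x))) ⟪v, y - x⟫_ℝ 0 := by
    have h1 : HasDerivAt (fun t : ℝ => x + t • (y - x)) (y - x) 0 := by
      simpa using ((hasDerivAt_id (0 : ℝ)).smul_const (y - x)).const_add x
    have h2 : HasFDerivAt φ (toDual ℝ E v) (x + (0 : ℝ) • (y - x)) := by
      simpa using hv.hasFDerivAt
    exact h2.comp_hasDerivAt (0 : ℝ) h1
  have hs := hd.tendsto_slope_zero_right
  have hr : Tendsto (fun t : ℝ => φ y - φ x - (1 - t) * (α / 2 * ‖y - x‖ ^ 2)) (𝓝[>] 0)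
      (𝓝 (φ y - φ x - (1 - 0) * (α / 2 * ‖y - x‖ ^ 2))) := by
    apply Tendsto.mono_left _ nhdsWithin_le_nhds
    exact Continuous.tendsto (by fun_prop) 0
  have hle : ∀ᶠ t : ℝ in 𝓝[>] 0, t⁻¹ • (φ (x + (0 + t) • (y - x)) - φ (x + (0 : ℝ) • (y - x)))
      ≤ φ y - φ x - (1 - t) * (α / 2 * ‖y - x‖ ^ 2) := by
    filter_upwards [Ioo_mem_nhdsGT (zero_lt_one' ℝ)] with t ht
    have h3 := h.2 (mem_univ x) (mem_univ y) (sub_nonneg.2 ht.2.le) ht.1.le (by ring)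
    have h4 : (1 - t) • x + t • y = x + t • (y - x) := by module
    rw [h4, norm_sub_rev x y] at h3
    simp only [smul_eq_mul, zero_add, zero_smul, add_zero] at h3 ⊢
    rw [inv_mul_le_iff₀ ht.1]
    linarith
  have := le_of_tendsto_of_tendsto hs hr hle
  linarith

/-- Gradients of differentiable strongly convex functions are strongly monotone. -/
theorem StrongConvexOn.inner_gradient_sub_ge {E : Type*} [NormedAddCommGroup E]
    [InnerProductSpace ℝ E] [CompleteSpace E] {φ : E → ℝ} {α : ℝ}
    (h : StrongConvexOn univ α φ) {x y v w : E} (hv : HasGradientAt φ v x)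
    (hw : HasGradientAt φ w y) : α * ‖y - x‖ ^ 2 ≤ ⟪w - v, y - x⟫_ℝ := by
  have h1 := h.lower_bound_of_hasGradientAt hv y
  have h2 := h.lower_bound_of_hasGradientAt hw x
  rw [norm_sub_rev x y, ← neg_sub y x, inner_neg_right] at h2
  rw [inner_sub_left]
  linarith

/-- The derivative of the gradient of a strongly convex function is coercive. -/
theorem StrongConvexOn.inner_hessian_ge {E : Type*} [NormedAddCommGroup E]
    [InnerProductSpace ℝ E] [CompleteSpace E] {φ : E → ℝ} {Φ : E → E} {H : E →L[ℝ] E} {α : ℝ}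
    {x : E} (h : StrongConvexOn univ α φ) (hΦ : ∀ y, HasGradientAt φ (Φ y) y)
    (hH : HasFDerivAt Φ H x) (v : E) : α * ‖v‖ ^ 2 ≤ ⟪H v, v⟫_ℝ := by
  have hd : HasDerivAt (fun t : ℝ => ⟪Φ (x + t • v), v⟫_ℝ) ⟪H v, v⟫_ℝ 0 := by
    have h1 : HasDerivAt (fun t : ℝ => x + t • v) v 0 := by
      simpa using ((hasDerivAt_id (0 : ℝ)).smul_const v).const_add x
    have h2 : HasFDerivAt Φ H (x + (0 : ℝ) • v) := by simpa using hH
    have h3 := h2.comp_hasDerivAt (0 : ℝ) h1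
    simpa using h3.inner ℝ (hasDerivAt_const (0 : ℝ) v)
  refine ge_of_tendsto hd.tendsto_slope_zero_right ?_
  filter_upwards [self_mem_nhdsWithin] with t ht
  have ht : 0 < t := ht
  have h4 := h.inner_gradient_sub_ge (hΦ x) (hΦ (x + t • v))
  simp only [add_sub_cancel_left, norm_smul, inner_smul_right, Real.norm_eq_abs, mul_pow, sq_abs,
    inner_sub_left] at h4
  simp only [zero_add, zero_smul, add_zero, smul_eq_mul]
  rw [le_inv_mul_iff₀ ht]
  -- Strong monotonicity between `x` and `x + t • v` carries a factor `t` on the right and `t²` on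
  -- the left.
  have : t * (t * (α * ‖v‖ ^ 2)) ≤ t * (⟪Φ (x + t • v), v⟫_ℝ - ⟪Φ x, v⟫_ℝ) := by linarith
  exact le_of_mul_le_mul_left this ht

/-- The derivative of a gradient field is symmetric. -/
theorem inner_hessian_comm {E : Type*} [NormedAddCommGroup E]
    [InnerProductSpace ℝ E] [CompleteSpace E] {φ : E → ℝ} {Φ : E → E} {H : E →L[ℝ] E}
    {x : E} (hΦ : ∀ y, HasGradientAt φ (Φ y) y)
    (hH : HasFDerivAt Φ H x) (v w : E) : ⟪H v, w⟫_ℝ = ⟪v, H w⟫_ℝ := by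
  let S : E →L[ℝ] E →L[ℝ] ℝ := innerSL ℝ
  have h1 : ∀ y, HasFDerivAt φ (S (Φ y)) y := fun y => (hΦ y).hasFDerivAt
  have h2 : HasFDerivAt (fun y => S (Φ y)) (S.comp H) x := S.hasFDerivAt.comp x hH
  have h3 : ⟪H v, w⟫_ℝ = ⟪H w, v⟫_ℝ := second_derivative_symmetric h1 h2 v w
  rw [h3, real_inner_comm]

/-! ### Saddle point systems in the energy norm -/

/-- If `T` is bounded below by `ω`, the equation `T* d = b` has a solution `d` in the range of `T`
of norm at most `‖b‖ / ω`. -/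
theorem exists_adjoint_eq_of_bounded_below {E F : Type*} [NormedAddCommGroup E]
    [InnerProductSpace ℝ E] [FiniteDimensional ℝ E] [NormedAddCommGroup F]
    [InnerProductSpace ℝ F] [FiniteDimensional ℝ F] (T : F →ₗ[ℝ] E) {ω : ℝ} (hω : 0 < ω)
    (hT : ∀ c, ω * ‖c‖ ≤ ‖T c‖) (b : F) :
    ∃ c : F, T.adjoint (T c) = b ∧ ‖T c‖ ≤ ‖b‖ / ω := by
  -- Since `⟪T* T c, c⟫ = ‖T c‖²`, the operator `T* T` is injective, hence surjective in finite
  -- dimension.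
  have hinj : Function.Injective (T.adjoint ∘ₗ T) := by
    rw [injective_iff_map_eq_zero]
    intro c hc
    have h1 : ⟪T c, T c⟫_ℝ = 0 := by
      rw [← LinearMap.adjoint_inner_right]
      simp only [LinearMap.comp_apply] at hc
      simp [hc]
    have h2 := hT c
    rw [inner_self_eq_zero.1 h1, norm_zero] at h2
    have : ‖c‖ ≤ 0 := by
      by_contra! h
      exact absurd h2 (not_le.2 (mul_pos hω h))
    exact norm_le_zero_iff.1 this
  obtain ⟨c, hc⟩ := LinearMap.surjective_of_injective hinj b
  refine ⟨c, hc, ?_⟩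
  have h1 : ‖T c‖ ^ 2 ≤ ‖c‖ * ‖b‖ := by
    rw [← real_inner_self_eq_norm_sq, ← LinearMap.adjoint_inner_right]
    have : T.adjoint (T c) = b := hc
    rw [this]
    exact real_inner_le_norm _ _
  rw [le_div_iff₀ hω]
  rcases (norm_nonneg (T c)).eq_or_lt with h0 | h0
  · rw [← h0]; simp
  · have h2 := mul_le_mul_of_nonneg_right (hT c) (norm_nonneg b)
    have : ‖T c‖ * (‖T c‖ * ω) ≤ ‖T c‖ * ‖b‖ := by nlinarith
    exact le_of_mul_le_mul_left this h0

/-- Thales' sphere: if the segment from `q` to `d` is seen from `u` under a right angle, then `u` and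
`u - q` are bounded by `‖q‖ + ‖d‖`. -/
theorem norm_le_of_inner_eq_zero {E : Type*} [NormedAddCommGroup E] [InnerProductSpace ℝ E]
    {u q d : E} (h : ⟪u - q, u - d⟫_ℝ = 0) : ‖u‖ ≤ ‖q‖ + ‖d‖ ∧ ‖u - q‖ ≤ ‖q‖ + ‖d‖ := by
  have h1 : ‖q - d‖ ^ 2 = ‖u - q‖ ^ 2 + ‖u - d‖ ^ 2 := by
    have := norm_sub_sq_real (u - d) (u - q)
    rw [real_inner_comm, h] at this
    rw [show u - d - (u - q) = q - d by abel] at this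
    linarith
  have h2 : ‖u - q‖ ≤ ‖q - d‖ := by
    apply le_of_sq_le_sq _ (norm_nonneg _)
    nlinarith [sq_nonneg ‖u - d‖]
  refine ⟨?_, h2.trans (norm_sub_le _ _)⟩
  -- `u` lies on the sphere with diameter from `q` to `d`, so `2 ‖u‖ ≤ ‖q - d‖ + ‖q + d‖`.
  have h3 : ‖(2 : ℝ) • u - (q + d)‖ = ‖q - d‖ := by
    have h4 : ‖(2 : ℝ) • u - (q + d)‖ ^ 2 = ‖q - d‖ ^ 2 := by
      have := norm_add_sq_real (u - q) (u - d)
      rw [h] at this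
      rw [show (2 : ℝ) • u - (q + d) = (u - q) + (u - d) by module, this, h1]
      ring
    exact (sq_eq_sq₀ (norm_nonneg _) (norm_nonneg _)).1 h4
  have h5 : ‖(2 : ℝ) • u‖ ≤ ‖(2 : ℝ) • u - (q + d)‖ + ‖q + d‖ := by
    simpa using norm_add_le ((2 : ℝ) • u - (q + d)) (q + d)
  rw [h3, norm_smul, Real.norm_two] at h5
  linarith [norm_sub_le q d, norm_add_le q d]

/-- The inner product `⟪H x, y⟫` given by a symmetric coercive operator `H`. -/
noncomputable abbrev energyCore {E : Type*} [NormedAddCommGroup E] [InnerProductSpace ℝ E]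
    (H : E →L[ℝ] E) {α : ℝ} (hα : 0 < α) (hsymm : ∀ v w, ⟪H v, w⟫_ℝ = ⟪v, H w⟫_ℝ)
    (hlow : ∀ v, α * ‖v‖ ^ 2 ≤ ⟪H v, v⟫_ℝ) : InnerProductSpace.Core ℝ E where
  inner x y := ⟪H x, y⟫_ℝ
  conj_inner_symm x y := by
    simp only [conj_trivial]
    rw [hsymm, real_inner_comm]
  re_inner_nonneg x := by
    simpa using le_trans (by positivity) (hlow x)
  add_left x y z := by simp [inner_add_left]
  smul_left x y r := by simp [inner_smul_left]
  definite x h := by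
    have h1 := hlow x
    have h : ⟪H x, x⟫_ℝ = 0 := h
    rw [h] at h1
    have h2 : ‖x‖ ^ 2 ≤ 0 := by
      by_contra! h3
      exact absurd h1 (not_le.2 (mul_pos hα h3))
    exact norm_eq_zero.1 (pow_eq_zero_iff two_ne_zero |>.1 (le_antisymm h2 (sq_nonneg _)))

/-- Thales' sphere in the energy norm of a symmetric coercive operator. -/
theorem sqrt_energy_le_of_inner_eq_zero {E : Type*} [NormedAddCommGroup E] [InnerProductSpace ℝ E]
    (H : E →L[ℝ] E) {α : ℝ} (hα : 0 < α) (hsymm : ∀ v w, ⟪H v, w⟫_ℝ = ⟪v, H w⟫_ℝ)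
    (hlow : ∀ v, α * ‖v‖ ^ 2 ≤ ⟪H v, v⟫_ℝ) {u q d : E} (h : ⟪H (u - q), u - d⟫_ℝ = 0) :
    √⟪H u, u⟫_ℝ ≤ √⟪H q, q⟫_ℝ + √⟪H d, d⟫_ℝ ∧
      √⟪H (u - q), u - q⟫_ℝ ≤ √⟪H q, q⟫_ℝ + √⟪H d, d⟫_ℝ :=
  -- The norm of this second inner product on `E` unfolds to `√⟪H u, u⟫`.
  let c := energyCore H hα hsymm hlow
  @norm_le_of_inner_eq_zero E c.toNormedAddCommGroup (InnerProductSpace.ofCore c.toCore) u q d h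

/-- The Cauchy-Schwarz inequality in the energy norm of a symmetric coercive operator. -/
theorem inner_le_sqrt_energy_mul {E : Type*} [NormedAddCommGroup E] [InnerProductSpace ℝ E]
    (H : E →L[ℝ] E) {α : ℝ} (hα : 0 < α) (hsymm : ∀ v w, ⟪H v, w⟫_ℝ = ⟪v, H w⟫_ℝ)
    (hlow : ∀ v, α * ‖v‖ ^ 2 ≤ ⟪H v, v⟫_ℝ) (u v : E) :
    ⟪H u, v⟫_ℝ ≤ √⟪H u, u⟫_ℝ * √⟪H v, v⟫_ℝ :=
  let c := energyCore H hα hsymm hlow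
  @real_inner_le_norm E c.toNormedAddCommGroup.toSeminormedAddCommGroup
    (InnerProductSpace.ofCore c.toCore) u v

/-- A priori bounds for the saddle point system `H x + T ν = a`, `T* x = b`. -/
theorem saddle_system_bound {E F : Type*} [NormedAddCommGroup E]
    [InnerProductSpace ℝ E] [FiniteDimensional ℝ E] [NormedAddCommGroup F]
    [InnerProductSpace ℝ F] [FiniteDimensional ℝ F] (H : E →L[ℝ] E) {α B : ℝ} (hα : 0 < α)
    (hB : 0 ≤ B) (hsymm : ∀ v w, ⟪H v, w⟫_ℝ = ⟪v, H w⟫_ℝ)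
    (hlow : ∀ v, α * ‖v‖ ^ 2 ≤ ⟪H v, v⟫_ℝ) (hup : ∀ v, ‖H v‖ ≤ B * ‖v‖)
    (T : F →ₗ[ℝ] E) {ω : ℝ} (hω : 0 < ω) (hT : ∀ c, ω * ‖c‖ ≤ ‖T c‖) {x a : E} {ν b : F}
    (h₁ : H x + T ν = a) (h₂ : T.adjoint x = b) :
    ‖x‖ ≤ √(B / α) * (‖a‖ / α + ‖b‖ / ω) ∧
      ‖ν‖ ≤ B / ω * √(B / α) * (‖a‖ / α + ‖b‖ / ω) := by
  -- The comparison `α ≤ B` needs a nonzero vector; in the zero space it may fail, but both unknowns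
  -- vanish.
  rcases subsingleton_or_nontrivial E with hE | hE
  · have hx : ‖x‖ = 0 := by rw [Subsingleton.elim x 0, norm_zero]
    have hν : ‖ν‖ ≤ 0 := by
      have := hT ν
      rw [Subsingleton.elim (T ν) 0, norm_zero] at this
      by_contra! h
      exact absurd this (not_le.2 (mul_pos hω h))
    constructor
    · rw [hx]; positivity
    · refine hν.trans ?_
      positivity
  have hαB : α ≤ B := by
    obtain ⟨v, hv⟩ := exists_ne (0 : E)
    have h3 : α * ‖v‖ ^ 2 ≤ B * ‖v‖ ^ 2 := by
      calc α * ‖v‖ ^ 2 ≤ ⟪H v, v⟫_ℝ := hlow v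
        _ ≤ ‖H v‖ * ‖v‖ := real_inner_le_norm _ _
        _ ≤ B * ‖v‖ * ‖v‖ := by gcongr; exact hup v
        _ = B * ‖v‖ ^ 2 := by ring
    exact le_of_mul_le_mul_right h3 (by have := norm_pos_iff.2 hv; positivity)
  have hBpos : 0 < B := hα.trans_le hαB
  obtain ⟨d, hd, hdn⟩ : ∃ d, T.adjoint d = b ∧ ‖d‖ ≤ ‖b‖ / ω := by
    obtain ⟨c, hc⟩ := exists_adjoint_eq_of_bounded_below T hω hT b
    exact ⟨T c, hc⟩
  obtain ⟨q, hq⟩ : ∃ q, H q = a := by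
    have hinj : Function.Injective (H : E →ₗ[ℝ] E) := by
      rw [injective_iff_map_eq_zero]
      intro v hv
      have hv : H v = 0 := hv
      have h3 := hlow v
      rw [hv, inner_zero_left] at h3
      by_contra! h4
      have := norm_pos_iff.2 h4
      exact absurd h3 (not_le.2 (by positivity))
    exact LinearMap.surjective_of_injective hinj a
  set N : E → ℝ := fun v => √⟪H v, v⟫_ℝ
  have hNnn : ∀ v, 0 ≤ N v := fun v => Real.sqrt_nonneg _
  have hEn : ∀ v, 0 ≤ ⟪H v, v⟫_ℝ := fun v => le_trans (by positivity) (hlow v)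
  have hNlow : ∀ v, √α * ‖v‖ ≤ N v := fun v => by
    apply Real.le_sqrt_of_sq_le
    rw [mul_pow, Real.sq_sqrt hα.le]
    exact hlow v
  have hNup : ∀ v, N v ≤ √B * ‖v‖ := fun v => by
    apply Real.sqrt_le_iff.2 ⟨by positivity, ?_⟩
    rw [mul_pow, Real.sq_sqrt hB]
    calc ⟪H v, v⟫_ℝ ≤ ‖H v‖ * ‖v‖ := real_inner_le_norm _ _
        _ ≤ B * ‖v‖ * ‖v‖ := by gcongr; exact hup v
        _ = B * ‖v‖ ^ 2 := by ring
  have hsα : 0 < √α := Real.sqrt_pos.2 hα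
  have hsB : 0 < √B := Real.sqrt_pos.2 hBpos
  have hNq : N q ≤ ‖a‖ / √α := by
    rw [le_div_iff₀ hsα]
    rcases (hNnn q).eq_or_lt with h0 | h0
    · rw [← h0]; simp
    · have h3 : N q * N q ≤ ‖a‖ * ‖q‖ := by
        have h5 : N q * N q = ⟪H q, q⟫_ℝ := Real.mul_self_sqrt (hEn q)
        rw [h5, hq]
        exact real_inner_le_norm _ _
      have h4 := mul_le_mul_of_nonneg_left (hNlow q) (norm_nonneg a)
      have : N q * (N q * √α) ≤ N q * ‖a‖ := by nlinarith
      exact le_of_mul_le_mul_left this h0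
  -- Cauchy-Schwarz in the energy norm, tested with `H w`: one factor `√B` remains in the energy
  -- norm, where the Thales bound is available.
  have hHN : ∀ w, ‖H w‖ ≤ √B * N w := fun w => by
    rcases (norm_nonneg (H w)).eq_or_lt with h0 | h0
    · rw [← h0]; have := hNnn w; positivity
    · have h3 := inner_le_sqrt_energy_mul H hα hsymm hlow w (H w)
      rw [real_inner_self_eq_norm_sq] at h3
      have h4 := mul_le_mul_of_nonneg_left (hNup (H w)) (hNnn w)
      have : ‖H w‖ * ‖H w‖ ≤ ‖H w‖ * (√B * N w) := by
        calc ‖H w‖ * ‖H w‖ = ‖H w‖ ^ 2 := by ring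
          _ ≤ N w * N (H w) := h3
          _ ≤ N w * (√B * ‖H w‖) := h4
          _ = _ := by ring
      exact le_of_mul_le_mul_left this h0
  -- `H (x - q) = -T ν` lies in the range of `T`, while `x - d` lies in the kernel of `T*`.
  have horth : ⟪H (x - q), x - d⟫_ℝ = 0 := by
    rw [map_sub, hq, ← h₁, sub_add_cancel_left, inner_neg_left, ← LinearMap.adjoint_inner_right,
      map_sub, h₂, hd, sub_self, inner_zero_right, neg_zero]
  obtain ⟨h3, h4⟩ := sqrt_energy_le_of_inner_eq_zero H hα hsymm hlow horth
  have hM : N q + N d ≤ √B * (‖a‖ / α + ‖b‖ / ω) := by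
    -- Weakening `1 / √α` to `√B / α` lets the two data terms share the factor `√B`.
    have e1 : ‖a‖ / √α ≤ √B * (‖a‖ / α) := by
      rw [div_le_iff₀ hsα]
      have : √α ≤ √B := Real.sqrt_le_sqrt hαB
      calc ‖a‖ = √α * (‖a‖ / α) * √α := by
            field_simp
            rw [Real.sq_sqrt hα.le]
        _ ≤ √B * (‖a‖ / α) * √α := by gcongr
    have e2 : N d ≤ √B * (‖b‖ / ω) := (hNup d).trans (by gcongr)
    linarith [hNq]
  constructor
  · rw [Real.sqrt_div hB]
    have := (hNlow x).trans (h3.trans hM)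
    rw [div_mul_eq_mul_div, le_div_iff₀ hsα]
    linarith
  · have h5 : ‖T ν‖ ≤ √B * (√B * (‖a‖ / α + ‖b‖ / ω)) := by
      have : T ν = -H (x - q) := by rw [map_sub, hq, ← h₁]; abel
      rw [this, norm_neg]
      exact (hHN _).trans (by gcongr; exact h4.trans hM)
    -- The argument gives `B / ω` for the multiplier; the factor `√(B / α) ≥ 1` is inserted only to
    -- reach the stated constant.
    have h6 : 1 ≤ √(B / α) := by
      rw [Real.one_le_sqrt, one_le_div hα]; exact hαB
    have h7 : ω * ‖ν‖ ≤ B * √(B / α) * (‖a‖ / α + ‖b‖ / ω) := by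
      calc ω * ‖ν‖ ≤ ‖T ν‖ := hT ν
        _ ≤ √B * (√B * (‖a‖ / α + ‖b‖ / ω)) := h5
        _ = B * 1 * (‖a‖ / α + ‖b‖ / ω) := by rw [← mul_assoc, Real.mul_self_sqrt hB, mul_one]
        _ ≤ _ := by gcongr
    rw [div_mul_eq_mul_div, div_mul_eq_mul_div, le_div_iff₀ hω]
    linarith

/-! ### From pointwise growth rates to Lipschitz bounds -/

/-- A function on a convex set, continuous there, whose pointwise upper growth rate is at most `C`,
is `C`-Lipschitz. -/
theorem norm_image_sub_le_of_eventually_le {V W : Type*} [NormedAddCommGroup V] [NormedSpace ℝ V]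
    [NormedAddCommGroup W] {s : Set V} (hs : Convex ℝ s) {φ : V → W}
    (hφ : ContinuousOn φ s) {C : ℝ}
    (h : ∀ x ∈ s, ∀ δ > 0, ∀ᶠ y in 𝓝[s] x, ‖φ y - φ x‖ ≤ (C + δ) * ‖y - x‖)
    {x y : V} (hx : x ∈ s) (hy : y ∈ s) : ‖φ y - φ x‖ ≤ C * ‖y - x‖ := by
  rcases eq_or_ne y x with rfl | hne
  · simp
  have hpos : 0 < ‖y - x‖ := norm_pos_iff.2 (sub_ne_zero.2 hne)
  set p : ℝ → V := fun t => x + t • (y - x) with hp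
  have hpc : Continuous p := by fun_prop
  have hps : MapsTo p (Icc 0 1) s := fun t ht =>
    hs.add_smul_sub_mem hx hy ht
  have hc : ContinuousOn (fun t => ‖φ (p t) - φ x‖) (Icc 0 1) :=
    ((hφ.comp hpc.continuousOn hps).sub continuousOn_const).norm
  have key := image_le_of_liminf_slope_right_le_deriv_boundary (B := fun t => C * ‖y - x‖ * t)
    (B' := fun _ => C * ‖y - x‖) hc (by simp [hp]) (by fun_prop)
    (fun t _ => by simpa using ((hasDerivAt_id t).const_mul (C * ‖y - x‖)).hasDerivWithinAt) ?_
    (right_mem_Icc.2 zero_le_one)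
  · simpa [hp] using key
  · intro t ht r hr
    apply Eventually.frequently
    -- Half the gap between `C` and `r / ‖y - x‖`, so that the slope along the segment stays
    -- strictly below `r`.
    have hδ : 0 < (r / ‖y - x‖ - C) / 2 := by
      have : C < r / ‖y - x‖ := by rwa [lt_div_iff₀ hpos]
      linarith
    have htend : Tendsto p (𝓝[>] t) (𝓝[s] (p t)) := by
      apply tendsto_nhdsWithin_of_tendsto_nhds_of_eventually_within
      · exact (hpc.tendsto t).mono_left nhdsWithin_le_nhds
      · filter_upwards [Ioo_mem_nhdsGT ht.2] with u hu
        exact hps ⟨ht.1.trans hu.1.le, hu.2.le⟩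
    filter_upwards [htend.eventually (h (p t) (hps ⟨ht.1, ht.2.le⟩) _ hδ), self_mem_nhdsWithin]
      with u hu hut
    have hut : 0 < u - t := sub_pos.2 hut
    have e1 : ‖p u - p t‖ = (u - t) * ‖y - x‖ := by
      rw [show p u - p t = (u - t) • (y - x) by simp only [hp]; module, norm_smul,
        Real.norm_of_nonneg hut.le]
    rw [slope_def_field, div_lt_iff₀ hut]
    have e2 : ‖φ (p u) - φ x‖ - ‖φ (p t) - φ x‖ ≤ ‖φ (p u) - φ (p t)‖ := by
      have := norm_sub_norm_le (φ (p u) - φ x) (φ (p t) - φ x)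
      rwa [sub_sub_sub_cancel_right] at this
    rw [e1] at hu
    have e3 : (C + (r / ‖y - x‖ - C) / 2) * ‖y - x‖ < r := by
      rw [← lt_div_iff₀ hpos]; linarith
    nlinarith [mul_lt_mul_of_pos_right e3 hut]

/-- Absorbing the error terms of a linearised two-component estimate. -/
theorem eventually_le_of_forall_eventually_le_add {X : Type*} {L : Filter X} {u w h : X → ℝ}
    {c₁ c₂ K c : ℝ} (hc₁ : 0 ≤ c₁) (hc₂ : 0 ≤ c₂) (hK : 0 ≤ K) (hc : 0 ≤ c)
    (hh : ∀ x, 0 ≤ h x) (hu : ∀ x, 0 ≤ u x) (hw : ∀ x, 0 ≤ w x)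
    (H : ∀ ε > 0, ∀ᶠ x in L, u x ≤ c₁ * (K * h x + ε * c * (u x + w x + h x)) ∧
      w x ≤ c₂ * (K * h x + ε * c * (u x + w x + h x))) {δ : ℝ} (hδ : 0 < δ) :
    ∀ᶠ x in L, u x ≤ (c₁ * K + δ) * h x ∧ w x ≤ (c₂ * K + δ) * h x := by
  -- Once the error coefficient is at most `1 / 2`, `s = u + w + h` satisfies `s ≤ (c₁ + c₂) K h + s
  -- / 2 + h`, that is `s ≤ D h`. A further shrinking of `ε` makes the remaining error at most `δ
  -- h`.
  set D := 2 * (c₁ + c₂) * K + 2 with hD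
  have hDp : 0 < D := by positivity
  obtain ⟨ε, hε, hε₁, hε₂⟩ : ∃ ε > 0, ε * (c * (c₁ + c₂)) ≤ 1 / 2 ∧
      ε * (c * (c₁ + c₂)) * D ≤ δ := by
    refine ⟨min (1 / 2) (δ / D) / (c * (c₁ + c₂) + 1), by positivity, ?_, ?_⟩
    · calc _ ≤ min (1 / 2) (δ / D) / (c * (c₁ + c₂) + 1) * (c * (c₁ + c₂) + 1) := by
            gcongr; linarith
        _ = min (1 / 2) (δ / D) := by field_simp
        _ ≤ _ := min_le_left _ _
    · calc _ ≤ min (1 / 2) (δ / D) / (c * (c₁ + c₂) + 1) * (c * (c₁ + c₂) + 1) * D := by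
            gcongr; linarith
        _ = min (1 / 2) (δ / D) * D := by field_simp
        _ ≤ δ / D * D := by gcongr; exact min_le_right _ _
        _ = δ := by field_simp
  filter_upwards [H ε hε] with x hx
  have hh := hh x
  have hu := hu x
  have hw := hw x
  obtain ⟨h1, h2⟩ := hx
  set s := u x + w x + h x with hs
  have hs0 : 0 ≤ s := by positivity
  have h3 : s ≤ D * h x := by
    have e1 := mul_le_mul_of_nonneg_right hε₁ hs0
    have : u x + w x ≤ (c₁ + c₂) * K * h x + 1 / 2 * s := by nlinarith
    rw [hD]; nlinarith
  have h4 : ε * (c * (c₁ + c₂)) * s ≤ δ * h x := by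
    calc _ ≤ ε * (c * (c₁ + c₂)) * (D * h x) := by gcongr
      _ = ε * (c * (c₁ + c₂)) * D * h x := by ring
      _ ≤ _ := by gcongr
  have p1 : 0 ≤ ε * c * c₁ * s := by positivity
  have p2 : 0 ≤ ε * c * c₂ * s := by positivity
  constructor <;> nlinarith

/-! ### Partial derivatives on `univ ×ˢ Ξ` -/

section Slices

variable {E V : Type*} [NormedAddCommGroup E] [InnerProductSpace ℝ E]
  [NormedAddCommGroup V] [NormedSpace ℝ V] {Ξ : Set V} {φ : E → V → ℝ}

/-- The domain is the whole space in the `x` direction, so a derivative within the product gives a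
full derivative in `x`, even when `ξ` is a boundary point of `Ξ`. -/
theorem hasFDerivAt_slice_left {W : Type*} [NormedAddCommGroup W] [NormedSpace ℝ W]
    {F : E × V → W} {D : E × V →L[ℝ] W} {x : E} {ξ : V}
    (h : HasFDerivWithinAt F D (univ ×ˢ Ξ) (x, ξ)) (hξ : ξ ∈ Ξ) :
    HasFDerivAt (fun y => F (y, ξ)) (D.comp (ContinuousLinearMap.inl ℝ E V)) x := by
  have hm : MapsTo (fun y : E => (y, ξ)) univ (univ ×ˢ Ξ) := fun y _ => ⟨mem_univ y, hξ⟩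
  exact hasFDerivWithinAt_univ.1
    (h.comp x (hasFDerivAt_prodMk_left x ξ).hasFDerivWithinAt hm)

theorem hasFDerivWithinAt_slice_right {W : Type*} [NormedAddCommGroup W] [NormedSpace ℝ W]
    {F : E × V → W} {D : E × V →L[ℝ] W} {x : E} {ξ : V}
    (h : HasFDerivWithinAt F D (univ ×ˢ Ξ) (x, ξ)) :
    HasFDerivWithinAt (fun η => F (x, η)) (D.comp (ContinuousLinearMap.inr ℝ E V)) Ξ ξ :=
  h.comp ξ (hasFDerivAt_prodMk_right x ξ).hasFDerivWithinAt (fun _ hη => ⟨mem_univ x, hη⟩)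

variable [CompleteSpace E]

theorem hasGradientAt_slice (h : DifferentiableOn ℝ (fun p : E × V => φ p.1 p.2) (univ ×ˢ Ξ))
    {ξ : V} (hξ : ξ ∈ Ξ) (x : E) :
    HasGradientAt (fun y => φ y ξ) (gradient (fun y => φ y ξ) x) x :=
  (hasFDerivAt_slice_left (h (x, ξ) ⟨mem_univ x, hξ⟩).hasFDerivWithinAt
    hξ).differentiableAt.hasGradientAt

/-- The partial gradient of a `C²` function is `C¹`. -/
theorem contDiffOn_gradient_slice (hΞ : UniqueDiffOn ℝ Ξ)
    (h : ContDiffOn ℝ 2 (fun p : E × V => φ p.1 p.2) (univ ×ˢ Ξ)) :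
    ContDiffOn ℝ 1 (fun p : E × V => gradient (fun y => φ y p.2) p.1) (univ ×ˢ Ξ) := by
  have hu : UniqueDiffOn ℝ ((univ : Set E) ×ˢ Ξ) := uniqueDiffOn_univ.prod hΞ
  let S : StrongDual ℝ E →L[ℝ] E := (toDual ℝ E).symm.toContinuousLinearEquiv.toContinuousLinearMap
  have h1 : ContDiffOn ℝ 1 (fun p : E × V => S ((fderivWithin ℝ (fun p : E × V => φ p.1 p.2)
      (univ ×ˢ Ξ) p).comp (ContinuousLinearMap.inl ℝ E V))) (univ ×ˢ Ξ) :=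
    S.contDiff.comp_contDiffOn
      ((h.fderivWithin hu (by norm_num)).clm_comp contDiffOn_const)
  refine h1.congr fun p hp => ?_
  have h2 := hasFDerivAt_slice_left
    ((h.differentiableOn (by norm_num)) p hp).hasFDerivWithinAt hp.2
  have h3 : fderiv ℝ (fun y => φ y p.2) p.1 = _ := h2.fderiv
  rw [gradient, h3]
  rfl

end Slices

/-! ### Combinations of gradients and existence of multipliers -/

/-- The linear combination `∑ cᵢ vᵢ` as a linear map on Euclidean space. -/
noncomputable def rowCombination {ι E : Type*} [Fintype ι] [AddCommGroup E] [Module ℝ E]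
    (v : ι → E) : EuclideanSpace ℝ ι →ₗ[ℝ] E where
  toFun c := ∑ i, c i • v i
  map_add' c d := by simp [add_smul, Finset.sum_add_distrib]
  map_smul' r c := by simp [mul_smul, Finset.smul_sum]

theorem rowCombination_apply {ι E : Type*} [Fintype ι] [AddCommGroup E] [Module ℝ E]
    (v : ι → E) (c : EuclideanSpace ℝ ι) : rowCombination v c = ∑ i, c i • v i := rfl

theorem rowCombination_adjoint_apply {ι E : Type*} [Fintype ι]
    [NormedAddCommGroup E] [InnerProductSpace ℝ E] [FiniteDimensional ℝ E]
    (v : ι → E) (d : E) (i : ι) : (rowCombination v).adjoint d i = ⟪v i, d⟫_ℝ := by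
  classical
  have h := LinearMap.adjoint_inner_right (rowCombination v) (EuclideanSpace.single i (1 : ℝ)) d
  rw [EuclideanSpace.inner_single_left] at h
  simpa [rowCombination_apply] using h

/-- If the rows `vᵢ` are uniformly independent and no direction strictly decreases all of them
together with `c₀`, then `c₀` is a nonpositive combination of the rows. -/
theorem exists_nonneg_multipliers {ι E : Type*} [Fintype ι] [NormedAddCommGroup E]
    [InnerProductSpace ℝ E] [FiniteDimensional ℝ E] {v : ι → E} {ω : ℝ} (hω : 0 < ω)
    (hT : ∀ c, ω * ‖c‖ ≤ ‖rowCombination v c‖) {c₀ : E}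
    (h : ∀ d, (∀ i, ⟪v i, d⟫_ℝ < 0) → 0 ≤ ⟪c₀, d⟫_ℝ) :
    ∃ μ : EuclideanSpace ℝ ι, (∀ i, 0 ≤ μ i) ∧ c₀ + rowCombination v μ = 0 := by
  classical
  set T := rowCombination v with hTdef
  -- Perturbing `d` by `ε` times a direction with `⟪v i, ·⟫ = -1` for all `i` makes the inequalities
  -- strict; then `ε → 0`.
  have hweak : ∀ d, (∀ i, ⟪v i, d⟫_ℝ ≤ 0) → 0 ≤ ⟪c₀, d⟫_ℝ := by
    intro d hd
    obtain ⟨c, hc, -⟩ := exists_adjoint_eq_of_bounded_below T hω hT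
      (WithLp.toLp 2 fun _ => (-1 : ℝ))
    have hc' : ∀ i, ⟪v i, T c⟫_ℝ = -1 := fun i => by
      rw [← rowCombination_adjoint_apply, ← hTdef, hc]
    have h1 : Tendsto (fun ε : ℝ => ⟪c₀, d + ε • T c⟫_ℝ) (𝓝[>] 0) (𝓝 ⟪c₀, d + (0 : ℝ) • T c⟫_ℝ) :=
      (Continuous.tendsto (by fun_prop) 0).mono_left nhdsWithin_le_nhds
    rw [zero_smul, add_zero] at h1
    refine ge_of_tendsto h1 ?_
    filter_upwards [self_mem_nhdsWithin] with ε hε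
    refine h _ fun i => ?_
    have hε : 0 < ε := hε
    rw [inner_add_right, inner_smul_right, hc']
    linarith [hd i]
  -- `-T μ` is the orthogonal projection of `c₀` onto the range of `T`. Testing `hweak` with minus
  -- the residual shows that the residual is zero.
  obtain ⟨μ, hμ, -⟩ := exists_adjoint_eq_of_bounded_below T hω hT (-T.adjoint c₀)
  have hw : c₀ + T μ = 0 := by
    have h1 : T.adjoint (c₀ + T μ) = 0 := by rw [map_add, hμ, add_neg_cancel]
    have h2 := hweak (-(c₀ + T μ)) fun i => by
      rw [inner_neg_right, ← rowCombination_adjoint_apply, ← hTdef, h1]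
      simp
    have h3 : ⟪T μ, c₀ + T μ⟫_ℝ = 0 := by
      rw [← LinearMap.adjoint_inner_right, h1, inner_zero_right]
    have h4 : ⟪c₀ + T μ, c₀ + T μ⟫_ℝ ≤ 0 := by
      rw [inner_add_left, h3]
      rw [inner_neg_right] at h2
      linarith
    rw [real_inner_self_eq_norm_sq] at h4
    exact norm_eq_zero.1 (pow_eq_zero_iff two_ne_zero |>.1 (le_antisymm h4 (sq_nonneg _)))
  refine ⟨μ, fun j => ?_, hw⟩
  -- A direction decreasing only the `j`-th row isolates the sign of `μ j`.
  obtain ⟨c, hc, -⟩ := exists_adjoint_eq_of_bounded_below T hω hT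
    (-EuclideanSpace.single j (1 : ℝ))
  have h1 := hweak (T c) fun i => by
    rw [← rowCombination_adjoint_apply, ← hTdef, hc]
    by_cases hij : i = j <;> simp [hij]
  rw [eq_neg_of_add_eq_zero_left hw, inner_neg_left, ← LinearMap.adjoint_inner_right, hc,
    inner_neg_right, EuclideanSpace.inner_single_right] at h1
  simpa using h1

/-! ### Restriction to a subset of the constraints -/

/-- Restriction of the coordinates to those satisfying `p`. -/
noncomputable def coordRestrict {ι : Type*} [Fintype ι] (p : ι → Prop) [DecidablePred p] :
    EuclideanSpace ℝ ι →L[ℝ] EuclideanSpace ℝ {i // p i} :=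
  LinearMap.toContinuousLinearMap
    { toFun := fun c => WithLp.toLp 2 fun i => c i.1
      map_add' := fun _ _ => rfl
      map_smul' := fun _ _ => rfl }

theorem coordRestrict_apply {ι : Type*} [Fintype ι] (p : ι → Prop) [DecidablePred p]
    (c : EuclideanSpace ℝ ι) (i : {i // p i}) : coordRestrict p c i = c i.1 := rfl

theorem norm_coordRestrict_le_of_imp {ι : Type*} [Fintype ι] {p q : ι → Prop} [DecidablePred p]
    [DecidablePred q] (h : ∀ i, p i → q i) (c : EuclideanSpace ℝ ι) :
    ‖coordRestrict p c‖ ≤ ‖coordRestrict q c‖ := by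
  rw [EuclideanSpace.norm_eq, EuclideanSpace.norm_eq]
  apply Real.sqrt_le_sqrt
  simp only [coordRestrict_apply]
  rw [← Finset.sum_subtype (Finset.univ.filter p) (by simp) (fun i => ‖c i‖ ^ 2),
    ← Finset.sum_subtype (Finset.univ.filter q) (by simp) (fun i => ‖c i‖ ^ 2)]
  exact Finset.sum_le_sum_of_subset_of_nonneg (fun i hi => by simp at hi ⊢; exact h i hi)
    (fun _ _ _ => by positivity)

theorem norm_coordRestrict_le {ι : Type*} [Fintype ι] (p : ι → Prop) [DecidablePred p]
    (c : EuclideanSpace ℝ ι) : ‖coordRestrict p c‖ ≤ ‖c‖ := by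
  rw [EuclideanSpace.norm_eq, EuclideanSpace.norm_eq]
  apply Real.sqrt_le_sqrt
  simp only [coordRestrict_apply]
  rw [← Finset.sum_subtype (Finset.univ.filter p) (by simp) (fun i => ‖c i‖ ^ 2)]
  exact Finset.sum_le_sum_of_subset_of_nonneg (Finset.subset_univ _) (fun _ _ _ => by positivity)

theorem norm_coordRestrict_of_support {ι : Type*} [Fintype ι] {p : ι → Prop} [DecidablePred p]
    {c : EuclideanSpace ℝ ι} (h : ∀ i, ¬ p i → c i = 0) : ‖coordRestrict p c‖ = ‖c‖ := by
  rw [EuclideanSpace.norm_eq, EuclideanSpace.norm_eq]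
  congr 1
  simp only [coordRestrict_apply]
  rw [← Finset.sum_subtype (Finset.univ.filter p) (by simp) (fun i => ‖c i‖ ^ 2)]
  exact Finset.sum_subset (Finset.subset_univ _) fun i _ hi => by
    rw [h i (by simpa using hi)]; simp

theorem rowCombination_coordRestrict {ι E : Type*} [Fintype ι] [AddCommGroup E] [Module ℝ E]
    {p : ι → Prop} [DecidablePred p] (v : ι → E) {c : EuclideanSpace ℝ ι}
    (h : ∀ i, ¬ p i → c i = 0) :
    rowCombination (fun i : {i // p i} => v i.1) (coordRestrict p c) = rowCombination v c := by
  simp only [rowCombination_apply, coordRestrict_apply]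
  rw [← Finset.sum_subtype (Finset.univ.filter p) (by simp) (fun i => c i • v i)]
  exact Finset.sum_subset (Finset.subset_univ _) fun i _ hi => by
    rw [h i (by simpa using hi), zero_smul]

/-- Every vector on the coordinates in `p` is the restriction of one supported on `p`. -/
theorem exists_coordRestrict_eq {ι : Type*} [Fintype ι] (p : ι → Prop) [DecidablePred p]
    (c : EuclideanSpace ℝ {i // p i}) :
    ∃ c' : EuclideanSpace ℝ ι, (∀ i, ¬ p i → c' i = 0) ∧ coordRestrict p c' = c := by
  refine ⟨WithLp.toLp 2 fun i => if h : p i then c ⟨i, h⟩ else 0, fun i hi => by simp [hi], ?_⟩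
  ext i
  simp [coordRestrict_apply, i.2]

/-! ### Existence and uniqueness of KKT pairs -/

namespace ParamProgram

variable {n m r : ℕ}

/-- The standing assumptions: a smooth, uniformly strongly convex program with uniform LICQ and
uniformly bounded multipliers. -/
structure IsRegular (Ξ : Set (Euc r)) (f : Euc n → Euc r → ℝ) (g : Euc n → Euc r → Euc m)
    (α : ℝ) (β : ℝ≥0) (l : Fin m → ℝ≥0) (ω : ℝ) (ζ : Fin m → ℝ) : Prop where
  convex : Convex ℝ Ξ
  interior_nonempty : (interior Ξ).Nonempty
  contDiffOn_f : ContDiffOn ℝ 2 (fun p : Euc n × Euc r => f p.1 p.2) (univ ×ˢ Ξ)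
  contDiffOn_g : ContDiffOn ℝ 2 (fun p : Euc n × Euc r => g p.1 p.2) (univ ×ˢ Ξ)
  feasible_nonempty : ∀ ξ ∈ Ξ, (feasible g ξ).Nonempty
  α_pos : 0 < α
  strongConvexOn_f : ∀ ξ ∈ Ξ, StrongConvexOn univ α (fun x => f x ξ)
  lipschitz_f : ∀ ξ ∈ Ξ, LipschitzWith β (gradient fun x => f x ξ)
  convexOn_g : ∀ ξ ∈ Ξ, ∀ i, ConvexOn ℝ univ (fun x => g x ξ i)
  lipschitz_g : ∀ ξ ∈ Ξ, ∀ i, LipschitzWith (l i) (gradient fun x => g x ξ i)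
  ω_pos : 0 < ω
  licq : UniformLICQ g Ξ ω
  ζ_pos : ∀ i, 0 < ζ i
  dual_bound : ∀ ξ ∈ Ξ, ∀ x μ, IsKKT f g ξ x μ → ∀ i, μ i ≤ ζ i

/-- The gradient in `x` of the `i`-th constraint. -/
noncomputable def gradG (g : Euc n → Euc r → Euc m) (x : Euc n) (ξ : Euc r) (i : Fin m) : Euc n :=
  gradient (fun y => g y ξ i) x

/-- The gradient in `x` of the objective. -/
noncomputable def gradF (f : Euc n → Euc r → ℝ) (x : Euc n) (ξ : Euc r) : Euc n :=
  gradient (fun y => f y ξ) x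

/-- The gradient in `x` of the Lagrangian. -/
noncomputable def gradL (f : Euc n → Euc r → ℝ) (g : Euc n → Euc r → Euc m) (x : Euc n) (μ : Euc m)
    (ξ : Euc r) : Euc n :=
  gradient (fun y => lagrangian f g y μ ξ) x

/-- A multiplier which vanishes on the inactive constraints does not contribute to the value. -/
theorem sum_mul_eq_zero {y : Euc m} {μ : Euc m} (hy : ∀ i, y i ≤ 0)
    (h : ∀ i, y i < 0 → μ i = 0) : ∑ i, μ i * y i = 0 :=
  Finset.sum_eq_zero fun i _ => by
    rcases (hy i).lt_or_eq with h1 | h1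
    · rw [h i h1, zero_mul]
    · rw [h1, mul_zero]

namespace IsRegular

variable {Ξ : Set (Euc r)} {f : Euc n → Euc r → ℝ} {g : Euc n → Euc r → Euc m}
  {α : ℝ} {β : ℝ≥0} {l : Fin m → ℝ≥0} {ω : ℝ} {ζ : Fin m → ℝ}
  {ξ : Euc r} {x : Euc n} {μ : Euc m}

theorem uniqueDiffOn (R : IsRegular Ξ f g α β l ω ζ) : UniqueDiffOn ℝ Ξ :=
  uniqueDiffOn_convex R.convex R.interior_nonempty

theorem contDiffOn_g_apply (R : IsRegular Ξ f g α β l ω ζ) (i : Fin m) :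
    ContDiffOn ℝ 2 (fun p : Euc n × Euc r => g p.1 p.2 i) (univ ×ˢ Ξ) :=
  (EuclideanSpace.proj (𝕜 := ℝ) i).contDiff.comp_contDiffOn R.contDiffOn_g

theorem contDiffOn_lagrangian (R : IsRegular Ξ f g α β l ω ζ) (μ : Euc m) :
    ContDiffOn ℝ 2 (fun p : Euc n × Euc r => lagrangian f g p.1 μ p.2) (univ ×ˢ Ξ) :=
  R.contDiffOn_f.add (ContDiffOn.sum fun i _ => contDiffOn_const.mul (R.contDiffOn_g_apply i))

theorem hasGradientAt_f (R : IsRegular Ξ f g α β l ω ζ) (hξ : ξ ∈ Ξ) (x : Euc n) :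
    HasGradientAt (fun y => f y ξ) (gradF f x ξ) x :=
  hasGradientAt_slice (R.contDiffOn_f.differentiableOn (by norm_num)) hξ x

theorem hasGradientAt_g (R : IsRegular Ξ f g α β l ω ζ) (hξ : ξ ∈ Ξ) (x : Euc n) (i : Fin m) :
    HasGradientAt (fun y => g y ξ i) (gradG g x ξ i) x :=
  hasGradientAt_slice (φ := fun y ξ => g y ξ i)
    ((R.contDiffOn_g_apply i).differentiableOn (by norm_num)) hξ x

theorem hasGradientAt_lagrangian (R : IsRegular Ξ f g α β l ω ζ) (hξ : ξ ∈ Ξ) (x : Euc n)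
    (μ : Euc m) : HasGradientAt (fun y => lagrangian f g y μ ξ) (gradL f g x μ ξ) x :=
  hasGradientAt_slice (φ := fun y ξ => lagrangian f g y μ ξ)
    ((R.contDiffOn_lagrangian μ).differentiableOn (by norm_num)) hξ x

theorem gradL_eq (R : IsRegular Ξ f g α β l ω ζ) (hξ : ξ ∈ Ξ) (x : Euc n) (μ : Euc m) :
    gradL f g x μ ξ = gradF f x ξ + rowCombination (gradG g x ξ) μ := by
  have h1 := (R.hasGradientAt_f hξ x).hasFDerivAt.add
    (HasFDerivAt.fun_sum (u := Finset.univ) fun i _ =>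
      (R.hasGradientAt_g hξ x i).hasFDerivAt.const_mul (μ i))
  have h2 := (R.hasGradientAt_lagrangian hξ x μ).hasFDerivAt.unique h1
  apply ext_inner_right ℝ
  intro v
  have h3 := DFunLike.congr_fun h2 v
  simpa [rowCombination_apply, inner_add_left, sum_inner, inner_smul_left] using h3

theorem continuousOn_gradF (R : IsRegular Ξ f g α β l ω ζ) :
    ContinuousOn (fun p : Euc n × Euc r => gradF f p.1 p.2) (univ ×ˢ Ξ) :=
  (contDiffOn_gradient_slice R.uniqueDiffOn R.contDiffOn_f).continuousOn

theorem continuousOn_gradG (R : IsRegular Ξ f g α β l ω ζ) (i : Fin m) :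
    ContinuousOn (fun p : Euc n × Euc r => gradG g p.1 p.2 i) (univ ×ˢ Ξ) :=
  (contDiffOn_gradient_slice (φ := fun y ξ => g y ξ i) R.uniqueDiffOn
    (R.contDiffOn_g_apply i)).continuousOn

theorem contDiffOn_gradL (R : IsRegular Ξ f g α β l ω ζ) (μ : Euc m) :
    ContDiffOn ℝ 1 (fun p : Euc n × Euc r => gradL f g p.1 μ p.2) (univ ×ˢ Ξ) :=
  contDiffOn_gradient_slice (φ := fun y ξ => lagrangian f g y μ ξ) R.uniqueDiffOn
    (R.contDiffOn_lagrangian μ)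

theorem strongConvexOn_lagrangian (R : IsRegular Ξ f g α β l ω ζ) (hξ : ξ ∈ Ξ)
    (hμ : ∀ i, 0 ≤ μ i) : StrongConvexOn univ α (fun y => lagrangian f g y μ ξ) := by
  have h1 : ConvexOn ℝ univ (fun y => ∑ i, μ i * g y ξ i) := by
    have h2 : ∀ s : Finset (Fin m), ConvexOn ℝ univ (fun y => ∑ i ∈ s, μ i * g y ξ i) := by
      classical
      intro s
      induction s using Finset.induction_on with
      | empty => simpa using convexOn_const (0 : ℝ) convex_univ
      | insert a s ha ih =>
        simp only [Finset.sum_insert ha]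
        exact ((R.convexOn_g ξ hξ a).smul (hμ a)).add ih
    exact h2 _
  have h3 := UniformConvexOn.add (R.strongConvexOn_f ξ hξ) (strongConvexOn_zero.2 h1)
  refine UniformConvexOn.mono (le_of_eq ?_) h3
  ext t
  simp

/-- LICQ: combinations of active gradients are bounded below. -/
theorem norm_rowCombination_ge (R : IsRegular Ξ f g α β l ω ζ) (hξ : ξ ∈ Ξ)
    (hx : x ∈ feasible g ξ) {c : Euc m} (hc : ∀ i, g x ξ i ≠ 0 → c i = 0) :
    ω * ‖c‖ ≤ ‖rowCombination (gradG g x ξ) c‖ := by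
  have hωp := R.ω_pos
  rw [← norm_coordRestrict_of_support (p := fun i => g x ξ i = 0) hc,
    ← rowCombination_coordRestrict (p := fun i => g x ξ i = 0) _ hc]
  rcases isEmpty_or_nonempty (Active g x ξ) with hA | hA
  · rw [Subsingleton.elim (coordRestrict (fun i => g x ξ i = 0) c) 0]
    simp
  set d := coordRestrict (fun i => g x ξ i = 0) c with hd
  have h1 := (R.licq ξ hξ x hx hA).dotProduct_mulVec_nonneg (WithLp.ofLp d)
  set J := activeJacobian g x ξ with hJ
  have e1 : ‖d‖ ^ 2 = WithLp.ofLp d ⬝ᵥ WithLp.ofLp d := by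
    rw [EuclideanSpace.norm_sq_eq, dotProduct]
    simp [sq]
  have e2 : ‖rowCombination (fun i : Active g x ξ => gradG g x ξ i.1) d‖ ^ 2 =
      Matrix.vecMul (WithLp.ofLp d) J ⬝ᵥ Matrix.vecMul (WithLp.ofLp d) J := by
    rw [EuclideanSpace.norm_sq_eq, dotProduct]
    refine Finset.sum_congr rfl fun j _ => ?_
    rw [Real.norm_eq_abs, sq_abs, sq]
    have : rowCombination (fun i : Active g x ξ => gradG g x ξ i.1) d j =
        Matrix.vecMul (WithLp.ofLp d) J j := by
      simp [rowCombination_apply, Matrix.vecMul, dotProduct, hJ, activeJacobian, gradG]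
    rw [this]
  -- The quadratic form of `J Jᵀ - ω² 𝕀` at `d` is `‖Jᵀ d‖² - ω² ‖d‖²`, and `Jᵀ d` is the row
  -- combination.
  rw [Matrix.sub_mulVec, dotProduct_sub, sub_nonneg, star_trivial, Matrix.smul_mulVec,
    Matrix.one_mulVec, dotProduct_smul, ← e1, ← Matrix.mulVec_mulVec, Matrix.dotProduct_mulVec,
    Matrix.mulVec_transpose, ← e2, smul_eq_mul, ← mul_pow] at h1
  exact le_of_sq_le_sq h1 (norm_nonneg _)

/-- LICQ for a subfamily of the active constraints. -/
theorem norm_rowCombination_subtype_ge (R : IsRegular Ξ f g α β l ω ζ) (hξ : ξ ∈ Ξ)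
    (hx : x ∈ feasible g ξ) {p : Fin m → Prop} [DecidablePred p] (hp : ∀ i, p i → g x ξ i = 0)
    (c : EuclideanSpace ℝ {i // p i}) :
    ω * ‖c‖ ≤ ‖rowCombination (fun i : {i // p i} => gradG g x ξ i.1) c‖ := by
  obtain ⟨c', h1, rfl⟩ := exists_coordRestrict_eq p c
  rw [norm_coordRestrict_of_support h1, rowCombination_coordRestrict _ h1]
  exact R.norm_rowCombination_ge hξ hx fun i hi => h1 i fun h => hi (hp i h)

theorem isClosed_feasible (R : IsRegular Ξ f g α β l ω ζ) (hξ : ξ ∈ Ξ) :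
    IsClosed (feasible g ξ) := by
  have : feasible g ξ = ⋂ i, {x | g x ξ i ≤ 0} := by ext; simp [feasible]
  rw [this]
  refine isClosed_iInter fun i => isClosed_le ?_ continuous_const
  exact continuous_iff_continuousAt.2 fun x => (R.hasGradientAt_g hξ x i).continuousAt

theorem convex_feasible (R : IsRegular Ξ f g α β l ω ζ) (hξ : ξ ∈ Ξ) :
    Convex ℝ (feasible g ξ) := by
  have : feasible g ξ = ⋂ i, {x | g x ξ i ≤ 0} := by ext; simp [feasible]
  rw [this]
  refine convex_iInter fun i => ?_
  simpa using (R.convexOn_g ξ hξ i).convex_le 0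

theorem exists_primalSolution (R : IsRegular Ξ f g α β l ω ζ) (hξ : ξ ∈ Ξ) :
    ∃ x, x ∈ primalSolutions f g ξ := by
  obtain ⟨x₀, hx₀⟩ := R.feasible_nonempty ξ hξ
  have hα := R.α_pos
  have hcont : Continuous (fun y => f y ξ) :=
    continuous_iff_continuousAt.2 fun x => (R.hasGradientAt_f hξ x).continuousAt
  refine hcont.continuousOn.exists_isMinOn' (R.isClosed_feasible hξ) hx₀ ?_
  apply Filter.Eventually.filter_mono inf_le_left
  -- Beyond this radius the quadratic term of the first-order lower bound dominates the linear one,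
  -- so `f` is at least its value at `x₀`.
  filter_upwards [(isCompact_closedBall x₀ (2 * ‖gradF f x₀ ξ‖ / α)).compl_mem_cocompact] with y hy
  have h1 := (R.strongConvexOn_f ξ hξ).lower_bound_of_hasGradientAt (R.hasGradientAt_f hξ x₀) y
  have h2 : 2 * ‖gradF f x₀ ξ‖ / α < ‖y - x₀‖ := by
    simpa [dist_eq_norm] using hy
  rw [div_lt_iff₀ hα] at h2
  have h3 := neg_le_of_abs_le (abs_real_inner_le_norm (gradF f x₀ ξ) (y - x₀))
  nlinarith [norm_nonneg (y - x₀), norm_nonneg (gradF f x₀ ξ)]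

theorem primalSolution_unique (R : IsRegular Ξ f g α β l ω ζ) (hξ : ξ ∈ Ξ) {y : Euc n}
    (hx : x ∈ primalSolutions f g ξ) (hy : y ∈ primalSolutions f g ξ) : x = y :=
  (((R.strongConvexOn_f ξ hξ).strictConvexOn R.α_pos).subset (subset_univ _)
    (R.convex_feasible hξ)).eq_of_isMinOn hx.2 hy.2 hx.1 hy.1

/-- A direction which strictly decreases all active constraints at a minimizer does not decrease
the objective. -/
theorem inner_gradF_nonneg (R : IsRegular Ξ f g α β l ω ζ) (hξ : ξ ∈ Ξ)
    (hx : x ∈ primalSolutions f g ξ) {d : Euc n}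
    (hd : ∀ i, g x ξ i = 0 → ⟪gradG g x ξ i, d⟫_ℝ < 0) : 0 ≤ ⟪gradF f x ξ, d⟫_ℝ := by
  have hline : ∀ {φ : Euc n → ℝ} {v : Euc n}, HasGradientAt φ v x →
      HasDerivAt (fun t : ℝ => φ (x + t • d)) ⟪v, d⟫_ℝ 0 := by
    intro φ v hv
    have h1 : HasDerivAt (fun t : ℝ => x + t • d) d 0 := by
      simpa using ((hasDerivAt_id (0 : ℝ)).smul_const d).const_add x
    have h2 : HasFDerivAt φ (toDual ℝ (Euc n) v) (x + (0 : ℝ) • d) := by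
      simpa using hv.hasFDerivAt
    exact h2.comp_hasDerivAt (0 : ℝ) h1
  -- Inactive constraints stay negative by continuity; active ones become negative by their negative
  -- slope.
  have hfeas : ∀ᶠ t : ℝ in 𝓝[>] 0, x + t • d ∈ feasible g ξ := by
    simp only [feasible, mem_ofPred_eq, eventually_all]
    intro i
    have h1 := hline (R.hasGradientAt_g hξ x i)
    rcases (hx.1 i).lt_or_eq with h0 | h0
    · have h2 : Tendsto (fun t : ℝ => g (x + t • d) ξ i) (𝓝[>] 0) (𝓝 (g x ξ i)) := by
        simpa using h1.continuousAt.tendsto.mono_left nhdsWithin_le_nhds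
      filter_upwards [h2.eventually_lt_const h0] with t ht using ht.le
    · filter_upwards [h1.tendsto_slope_zero_right.eventually_lt_const (hd i h0),
        self_mem_nhdsWithin] with t ht ht0
      have ht0 : 0 < t := ht0
      simp only [zero_add, zero_smul, add_zero, smul_eq_mul, h0, sub_zero] at ht
      by_contra! h3
      exact absurd ht (not_lt.2 (by positivity))
  refine ge_of_tendsto (hline (R.hasGradientAt_f hξ x)).tendsto_slope_zero_right ?_
  filter_upwards [hfeas, self_mem_nhdsWithin] with t ht ht0
  have ht0 : 0 < t := ht0
  have h4 : f x ξ ≤ f (x + t • d) ξ := hx.2 ht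
  simp only [zero_add, zero_smul, add_zero, smul_eq_mul]
  have := sub_nonneg.2 h4
  positivity

theorem exists_isKKT (R : IsRegular Ξ f g α β l ω ζ) (hξ : ξ ∈ Ξ)
    (hx : x ∈ primalSolutions f g ξ) : ∃ μ, IsKKT f g ξ x μ := by
  obtain ⟨ν, hν, h1⟩ := exists_nonneg_multipliers R.ω_pos
    (R.norm_rowCombination_subtype_ge (p := fun i => g x ξ i = 0) hξ hx.1 fun _ h => h)
    (c₀ := gradF f x ξ)
    (fun d hd => R.inner_gradF_nonneg hξ hx fun i hi => hd ⟨i, hi⟩)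
  obtain ⟨μ, hμ, rfl⟩ := exists_coordRestrict_eq _ ν
  rw [rowCombination_coordRestrict _ hμ, ← R.gradL_eq hξ] at h1
  refine ⟨μ, hx.1, fun i => ?_, h1, fun i hi => hμ i hi.ne⟩
  by_cases hi : g x ξ i = 0
  · exact hν ⟨i, hi⟩
  · rw [hμ i hi]

/-- The difference of two multipliers is supported on the active set and annihilated by the
combination of gradients, so LICQ forces it to vanish. -/
theorem isKKT_unique (R : IsRegular Ξ f g α β l ω ζ) (hξ : ξ ∈ Ξ) {ν : Euc m}
    (hμ : IsKKT f g ξ x μ) (hν : IsKKT f g ξ x ν) : μ = ν := by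
  have h1 : rowCombination (gradG g x ξ) (μ - ν) = 0 := by
    have e1 : gradL f g x μ ξ = 0 := hμ.stationary
    have e2 : gradL f g x ν ξ = 0 := hν.stationary
    rw [R.gradL_eq hξ] at e1 e2
    rw [map_sub, ← add_sub_add_left_eq_sub _ _ (gradF f x ξ), e1, e2, sub_zero]
  have h2 := R.norm_rowCombination_ge hξ hμ.feasible (c := μ - ν) fun i hi => by
    have hlt := lt_of_le_of_ne (hμ.feasible i) hi
    simp [hμ.slack i hlt, hν.slack i hlt]
  rw [h1, norm_zero] at h2
  by_contra! h3
  have := norm_pos_iff.2 (sub_ne_zero.2 h3)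
  have hω := R.ω_pos
  exact absurd h2 (not_le.2 (by positivity))

/-- The primal and dual solution maps are single-valued. -/
theorem exists_solutionMaps (R : IsRegular Ξ f g α β l ω ζ) :
    ∃ (xs : Euc r → Euc n) (μs : Euc r → Euc m),
      (∀ ξ ∈ Ξ, primalSolutions f g ξ = {xs ξ}) ∧ (∀ ξ ∈ Ξ, dualSolutions f g ξ = {μs ξ}) ∧
      ∀ ξ ∈ Ξ, IsKKT f g ξ (xs ξ) (μs ξ) := by
  classical
  have h : ∀ ξ, ∃ (x : Euc n) (μ : Euc m), ξ ∈ Ξ → x ∈ primalSolutions f g ξ ∧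
      IsKKT f g ξ x μ := by
    intro ξ
    by_cases hξ : ξ ∈ Ξ
    · obtain ⟨x, hx⟩ := R.exists_primalSolution hξ
      obtain ⟨μ, hμ⟩ := R.exists_isKKT hξ hx
      exact ⟨x, μ, fun _ => ⟨hx, hμ⟩⟩
    · exact ⟨0, 0, fun h => absurd h hξ⟩
  choose xs μs hs using h
  refine ⟨xs, μs, fun ξ hξ => ?_, fun ξ hξ => ?_, fun ξ hξ => (hs ξ hξ).2⟩
  · exact eq_singleton_iff_unique_mem.2
      ⟨(hs ξ hξ).1, fun y hy => R.primalSolution_unique hξ hy (hs ξ hξ).1⟩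
  · refine eq_singleton_iff_unique_mem.2 ⟨⟨xs ξ, hs ξ hξ⟩, ?_⟩
    rintro ν ⟨y, hy, hν⟩
    rw [R.primalSolution_unique hξ hy (hs ξ hξ).1] at hν
    exact R.isKKT_unique hξ hν (hs ξ hξ).2

end IsRegular

end ParamProgram

/-! ### Continuity and linearised stability of the solution maps -/

namespace ParamProgram

namespace IsRegular

variable {n m r : ℕ} {Ξ : Set (Euc r)} {f : Euc n → Euc r → ℝ} {g : Euc n → Euc r → Euc m}
  {α : ℝ} {β : ℝ≥0} {l : Fin m → ℝ≥0} {ω : ℝ} {ζ : Fin m → ℝ}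
  {ξ ξ₀ : Euc r} {x x₀ : Euc n} {μ μ₀ : Euc m}

/-- The basic stability estimate between KKT points at two parameters. -/
theorem sq_norm_sub_le (R : IsRegular Ξ f g α β l ω ζ) (hξ : ξ ∈ Ξ) (hξ₀ : ξ₀ ∈ Ξ)
    (h : IsKKT f g ξ x μ) (h₀ : IsKKT f g ξ₀ x₀ μ₀) :
    ‖x - x₀‖ ^ 2 ≤ 2 / α * ∑ i, ζ i * |g x₀ ξ i - g x₀ ξ₀ i| +
      (‖gradL f g x₀ μ₀ ξ‖ / α) ^ 2 := by
  have hα := R.α_pos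
  -- Strong convexity at the single parameter `ξ` is used twice: with `μ` from `x` to `x₀`, and with
  -- `μ₀` from `x₀` to `x`. In the sum the objective cancels, and complementarity and feasibility
  -- leave only the change of `g x₀`.
  have h1 := (R.strongConvexOn_lagrangian hξ h.nonneg).lower_bound_of_hasGradientAt
    (R.hasGradientAt_lagrangian hξ x μ) x₀
  have hs : gradL f g x μ ξ = 0 := h.stationary
  rw [hs, inner_zero_left, norm_sub_rev] at h1
  have h2 := (R.strongConvexOn_lagrangian hξ h₀.nonneg).lower_bound_of_hasGradientAt
    (R.hasGradientAt_lagrangian hξ x₀ μ₀) x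
  have h3 := neg_le_of_abs_le (abs_real_inner_le_norm (gradL f g x₀ μ₀ ξ) (x - x₀))
  have e1 : ∑ i, μ i * g x ξ i = 0 := sum_mul_eq_zero h.feasible h.slack
  have e2 : ∑ i, μ₀ i * g x ξ i ≤ 0 :=
    Finset.sum_nonpos fun i _ => mul_nonpos_of_nonneg_of_nonpos (h₀.nonneg i) (h.feasible i)
  have e3 : ∑ i, μ₀ i * g x₀ ξ₀ i = 0 := sum_mul_eq_zero h₀.feasible h₀.slack
  have e4 : ∑ i, μ i * g x₀ ξ₀ i ≤ 0 :=
    Finset.sum_nonpos fun i _ => mul_nonpos_of_nonneg_of_nonpos (h.nonneg i) (h₀.feasible i)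
  have e5 : ∑ i, (μ i - μ₀ i) * (g x₀ ξ i - g x₀ ξ₀ i) ≤
      ∑ i, ζ i * |g x₀ ξ i - g x₀ ξ₀ i| := by
    refine Finset.sum_le_sum fun i _ => (le_abs_self _).trans ?_
    rw [abs_mul]
    gcongr
    rw [abs_le]
    constructor <;> linarith [h.nonneg i, h₀.nonneg i, R.dual_bound ξ hξ x μ h i,
      R.dual_bound ξ₀ hξ₀ x₀ μ₀ h₀ i]
  have e6 : ∑ i, (μ i - μ₀ i) * (g x₀ ξ i - g x₀ ξ₀ i) =
      ∑ i, μ i * g x₀ ξ i - ∑ i, μ₀ i * g x₀ ξ i - ∑ i, μ i * g x₀ ξ₀ i +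
        ∑ i, μ₀ i * g x₀ ξ₀ i := by
    rw [← Finset.sum_sub_distrib, ← Finset.sum_sub_distrib, ← Finset.sum_add_distrib]
    exact Finset.sum_congr rfl fun i _ => by ring
  simp only [lagrangian] at h1 h2
  set S := ∑ i, ζ i * |g x₀ ξ i - g x₀ ξ₀ i|
  set p := ‖gradL f g x₀ μ₀ ξ‖
  set s := ‖x - x₀‖
  have h4 : α * s ^ 2 ≤ S + p * s := by linarith
  have h5 : p * s ≤ α * (p / α) ^ 2 / 2 + α * s ^ 2 / 2 := by
    have : p = α * (p / α) := by field_simp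
    have h6 : p * s = α * (p / α * s) := by rw [← mul_assoc, ← this]
    nlinarith [sq_nonneg (p / α - s)]
  have h7 : α * s ^ 2 ≤ α * (2 / α * S + (p / α) ^ 2) := by
    have : α * (2 / α * S) = 2 * S := by field_simp
    rw [mul_add, this]
    linarith
  exact le_of_mul_le_mul_left h7 hα

theorem tendsto_gradL_right (R : IsRegular Ξ f g α β l ω ζ) (hξ₀ : ξ₀ ∈ Ξ) (x₀ : Euc n)
    (μ₀ : Euc m) : Tendsto (fun ξ => gradL f g x₀ μ₀ ξ) (𝓝[Ξ] ξ₀) (𝓝 (gradL f g x₀ μ₀ ξ₀)) :=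
  ((R.contDiffOn_gradL μ₀).continuousOn.comp (f := fun ξ => (x₀, ξ)) (by fun_prop)
    (fun _ hη => ⟨mem_univ _, hη⟩)) ξ₀ hξ₀

theorem tendsto_g_right (R : IsRegular Ξ f g α β l ω ζ) (hξ₀ : ξ₀ ∈ Ξ) (x₀ : Euc n) (i : Fin m) :
    Tendsto (fun ξ => g x₀ ξ i) (𝓝[Ξ] ξ₀) (𝓝 (g x₀ ξ₀ i)) :=
  ((R.contDiffOn_g_apply i).continuousOn.comp (f := fun ξ => (x₀, ξ)) (by fun_prop)
    (fun _ hη => ⟨mem_univ _, hη⟩)) ξ₀ hξ₀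

variable {xs : Euc r → Euc n} {μs : Euc r → Euc m}

/-- The stability estimate bounds only the square of the distance, so it is of Hölder type with
exponent `1 / 2`; that is enough for continuity. -/
theorem continuousOn_primal (R : IsRegular Ξ f g α β l ω ζ)
    (hs : ∀ ξ ∈ Ξ, IsKKT f g ξ (xs ξ) (μs ξ)) : ContinuousOn xs Ξ := by
  intro ξ₀ hξ₀
  have h0 : gradL f g (xs ξ₀) (μs ξ₀) ξ₀ = 0 := (hs ξ₀ hξ₀).stationary
  have h1 : Tendsto (fun ξ => 2 / α * ∑ i, ζ i * |g (xs ξ₀) ξ i - g (xs ξ₀) ξ₀ i| +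
      (‖gradL f g (xs ξ₀) (μs ξ₀) ξ‖ / α) ^ 2) (𝓝[Ξ] ξ₀)
      (𝓝 (2 / α * ∑ i, ζ i * |g (xs ξ₀) ξ₀ i - g (xs ξ₀) ξ₀ i| +
      (‖gradL f g (xs ξ₀) (μs ξ₀) ξ₀‖ / α) ^ 2)) := by
    refine Tendsto.add (Tendsto.const_mul _ (tendsto_finsetSum _ fun i _ =>
      Tendsto.const_mul _ ((R.tendsto_g_right hξ₀ _ i).sub_const _).abs)) ?_
    exact ((R.tendsto_gradL_right hξ₀ _ _).norm.div_const _).pow 2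
  simp only [sub_self, abs_zero, mul_zero, Finset.sum_const_zero, h0, norm_zero, zero_div, ne_eq,
    OfNat.ofNat_ne_zero, not_false_eq_true, zero_pow, add_zero] at h1
  have h2 : Tendsto (fun ξ => ‖xs ξ - xs ξ₀‖ ^ 2) (𝓝[Ξ] ξ₀) (𝓝 0) := by
    refine tendsto_of_tendsto_of_tendsto_of_le_of_le' tendsto_const_nhds h1
      (Eventually.of_forall fun ξ => by positivity) ?_
    filter_upwards [self_mem_nhdsWithin] with ξ hξ
    exact R.sq_norm_sub_le hξ hξ₀ (hs ξ hξ) (hs ξ₀ hξ₀)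
  have h3 := h2.sqrt
  simp only [Real.sqrt_zero, Real.sqrt_sq (norm_nonneg _)] at h3
  exact tendsto_iff_norm_sub_tendsto_zero.2 h3

/-- The solution curve in the product space. -/
theorem tendsto_graph (R : IsRegular Ξ f g α β l ω ζ)
    (hs : ∀ ξ ∈ Ξ, IsKKT f g ξ (xs ξ) (μs ξ)) (hξ₀ : ξ₀ ∈ Ξ) :
    Tendsto (fun ξ => (xs ξ, ξ)) (𝓝[Ξ] ξ₀) (𝓝[univ ×ˢ Ξ] (xs ξ₀, ξ₀)) := by
  apply tendsto_nhdsWithin_of_tendsto_nhds_of_eventually_within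
  · exact Tendsto.prodMk_nhds (R.continuousOn_primal hs ξ₀ hξ₀)
      (tendsto_id.mono_left nhdsWithin_le_nhds)
  · filter_upwards [self_mem_nhdsWithin] with ξ hξ using ⟨mem_univ _, hξ⟩

theorem tendsto_gradG (R : IsRegular Ξ f g α β l ω ζ)
    (hs : ∀ ξ ∈ Ξ, IsKKT f g ξ (xs ξ) (μs ξ)) (hξ₀ : ξ₀ ∈ Ξ) (i : Fin m) :
    Tendsto (fun ξ => ‖gradG g (xs ξ) ξ i - gradG g (xs ξ₀) ξ₀ i‖) (𝓝[Ξ] ξ₀) (𝓝 0) :=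
  tendsto_iff_norm_sub_tendsto_zero.1
    ((R.continuousOn_gradG i (xs ξ₀, ξ₀) ⟨mem_univ _, hξ₀⟩).tendsto.comp (R.tendsto_graph hs hξ₀))

/-- Constraints which are inactive at `ξ₀` stay inactive nearby. -/
theorem eventually_inactive (R : IsRegular Ξ f g α β l ω ζ)
    (hs : ∀ ξ ∈ Ξ, IsKKT f g ξ (xs ξ) (μs ξ)) (hξ₀ : ξ₀ ∈ Ξ) :
    ∀ᶠ ξ in 𝓝[Ξ] ξ₀, ∀ i, g (xs ξ₀) ξ₀ i ≠ 0 → g (xs ξ) ξ i < 0 := by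
  rw [eventually_all]
  intro i
  by_cases hi : g (xs ξ₀) ξ₀ i = 0
  · exact Eventually.of_forall fun ξ h => absurd hi h
  · have h1 := ((R.contDiffOn_g_apply i).continuousOn (xs ξ₀, ξ₀)
      ⟨mem_univ _, hξ₀⟩).tendsto.comp (R.tendsto_graph hs hξ₀)
    filter_upwards [h1.eventually_lt_const (lt_of_le_of_ne ((hs ξ₀ hξ₀).feasible i) hi)] with ξ h _
      using h

/-- Near `ξ₀` the multiplier increment is supported on the active set at `ξ₀`. LICQ there bounds it
by the variation of the gradients, whose coefficients are controlled by `ζ`. -/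
theorem continuousOn_dual (R : IsRegular Ξ f g α β l ω ζ)
    (hs : ∀ ξ ∈ Ξ, IsKKT f g ξ (xs ξ) (μs ξ)) : ContinuousOn μs Ξ := by
  intro ξ₀ hξ₀
  have hω := R.ω_pos
  have hF : Tendsto (fun ξ => ‖gradF f (xs ξ) ξ - gradF f (xs ξ₀) ξ₀‖) (𝓝[Ξ] ξ₀) (𝓝 0) :=
    tendsto_iff_norm_sub_tendsto_zero.1
      ((R.continuousOn_gradF (xs ξ₀, ξ₀) ⟨mem_univ _, hξ₀⟩).tendsto.comp (R.tendsto_graph hs hξ₀))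
  have h1 : Tendsto (fun ξ => (‖gradF f (xs ξ) ξ - gradF f (xs ξ₀) ξ₀‖ +
      ∑ i, ζ i * ‖gradG g (xs ξ) ξ i - gradG g (xs ξ₀) ξ₀ i‖) / ω) (𝓝[Ξ] ξ₀)
      (𝓝 ((0 + ∑ i, ζ i * 0) / ω)) :=
    (hF.add (tendsto_finsetSum _ fun i _ =>
      (R.tendsto_gradG hs hξ₀ i).const_mul _)).div_const _
  simp only [mul_zero, Finset.sum_const_zero, add_zero, zero_div] at h1
  refine tendsto_iff_norm_sub_tendsto_zero.2 ?_
  refine tendsto_of_tendsto_of_tendsto_of_le_of_le' tendsto_const_nhds h1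
    (Eventually.of_forall fun ξ => by positivity) ?_
  filter_upwards [self_mem_nhdsWithin, R.eventually_inactive hs hξ₀] with ξ hξ hin
  have h := hs ξ hξ
  have h₀ := hs ξ₀ hξ₀
  have h2 := R.norm_rowCombination_ge hξ₀ h₀.feasible (c := μs ξ - μs ξ₀) fun i hi => by
    simp [h.slack i (hin i hi), h₀.slack i (lt_of_le_of_ne (h₀.feasible i) hi)]
  have h3 : rowCombination (gradG g (xs ξ₀) ξ₀) (μs ξ - μs ξ₀) =
      -(gradF f (xs ξ) ξ - gradF f (xs ξ₀) ξ₀) -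
        ∑ i, μs ξ i • (gradG g (xs ξ) ξ i - gradG g (xs ξ₀) ξ₀ i) := by
    have e1 : gradL f g (xs ξ) (μs ξ) ξ = 0 := h.stationary
    have e2 : gradL f g (xs ξ₀) (μs ξ₀) ξ₀ = 0 := h₀.stationary
    rw [R.gradL_eq hξ] at e1
    rw [R.gradL_eq hξ₀] at e2
    simp only [smul_sub, Finset.sum_sub_distrib]
    rw [map_sub, eq_neg_of_add_eq_zero_left e1, eq_neg_of_add_eq_zero_left e2]
    simp only [rowCombination_apply]
    abel
  rw [le_div_iff₀ hω, mul_comm]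
  refine h2.trans ?_
  rw [h3]
  refine (norm_sub_le _ _).trans ?_
  rw [norm_neg]
  gcongr
  refine (norm_sum_le _ _).trans (Finset.sum_le_sum fun i _ => ?_)
  rw [norm_smul, Real.norm_of_nonneg (h.nonneg i)]
  gcongr
  exact R.dual_bound ξ hξ _ _ h i

/-- The origin of the constant `B`: it bounds the operator norm of the Hessian of the Lagrangian at
a KKT multiplier. -/
theorem norm_gradL_sub_le (R : IsRegular Ξ f g α β l ω ζ) (hξ : ξ ∈ Ξ) (h : IsKKT f g ξ x μ)
    (y z : Euc n) :
    ‖gradL f g y μ ξ - gradL f g z μ ξ‖ ≤ (β + ∑ i, ζ i * l i) * ‖y - z‖ := by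
  rw [R.gradL_eq hξ, R.gradL_eq hξ, add_sub_add_comm, rowCombination_apply, rowCombination_apply,
    ← Finset.sum_sub_distrib, add_mul, Finset.sum_mul]
  refine (norm_add_le _ _).trans (add_le_add ?_ ((norm_sum_le _ _).trans
    (Finset.sum_le_sum fun i _ => ?_)))
  · simpa [dist_eq_norm, gradF] using (R.lipschitz_f ξ hξ).dist_le_mul y z
  · rw [← smul_sub, norm_smul, Real.norm_of_nonneg (h.nonneg i), mul_assoc]
    have h1 : ‖gradG g y ξ i - gradG g z ξ i‖ ≤ l i * ‖y - z‖ := by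
      simpa [dist_eq_norm, gradG] using (R.lipschitz_g ξ hξ i).dist_le_mul y z
    have := R.dual_bound ξ hξ _ _ h i
    have := R.ζ_pos i
    gcongr

/-- The linearised KKT system yields the growth estimate of the solutions, up to relatively
small errors. -/
theorem eventually_norm_le (R : IsRegular Ξ f g α β l ω ζ)
    (hs : ∀ ξ ∈ Ξ, IsKKT f g ξ (xs ξ) (μs ξ)) (hξ₀ : ξ₀ ∈ Ξ) {B : ℝ}
    (hB : B = β + ∑ i, ζ i * l i) {ε : ℝ} (hε : 0 < ε) :
    ∀ᶠ ξ in 𝓝[Ξ] ξ₀,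
      ‖xs ξ - xs ξ₀‖ ≤ √(B / α) * ((‖mixedHessian f g Ξ (xs ξ₀) (μs ξ₀) ξ₀‖ / α +
          ‖activeParamDeriv g Ξ (xs ξ₀) ξ₀‖ / ω) * ‖ξ - ξ₀‖ +
        ε * (1 / α + 1 / ω) * (‖xs ξ - xs ξ₀‖ + ‖μs ξ - μs ξ₀‖ + ‖ξ - ξ₀‖)) ∧
      ‖μs ξ - μs ξ₀‖ ≤ B / ω * √(B / α) * ((‖mixedHessian f g Ξ (xs ξ₀) (μs ξ₀) ξ₀‖ / α +
          ‖activeParamDeriv g Ξ (xs ξ₀) ξ₀‖ / ω) * ‖ξ - ξ₀‖ +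
        ε * (1 / α + 1 / ω) * (‖xs ξ - xs ξ₀‖ + ‖μs ξ - μs ξ₀‖ + ‖ξ - ξ₀‖)) := by
  have hα := R.α_pos
  have hω := R.ω_pos
  have h₀ := hs ξ₀ hξ₀
  have hB0 : 0 ≤ B := by
    rw [hB]
    exact add_nonneg β.2 (Finset.sum_nonneg fun i _ => mul_nonneg (R.ζ_pos i).le (l i).2)
  set x₀ := xs ξ₀ with hx₀
  set μ₀ := μs ξ₀ with hμ₀
  have hmem : (x₀, ξ₀) ∈ (univ : Set (Euc n)) ×ˢ Ξ := ⟨mem_univ _, hξ₀⟩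
  obtain ⟨D, hD⟩ := (R.contDiffOn_gradL μ₀).differentiableOn (by norm_num) _ hmem
  obtain ⟨Q, hQ⟩ := R.contDiffOn_g.differentiableOn (by norm_num) _ hmem
  set H : Euc n →L[ℝ] Euc n := D.comp (ContinuousLinearMap.inl ℝ _ _) with hH
  have hHd : HasFDerivAt (fun y => gradL f g y μ₀ ξ₀) H x₀ := hasFDerivAt_slice_left hD hξ₀
  have hgrad := fun y => R.hasGradientAt_lagrangian hξ₀ y μ₀
  have hsymm := inner_hessian_comm hgrad hHd
  have hlow := (R.strongConvexOn_lagrangian hξ₀ h₀.nonneg).inner_hessian_ge hgrad hHd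
  have hup : ∀ v, ‖H v‖ ≤ B * ‖v‖ := by
    have : ‖H‖ ≤ B := hHd.le_of_lip' hB0 (Eventually.of_forall fun y => by
      rw [hB]; exact R.norm_gradL_sub_le hξ₀ h₀ y x₀)
    exact fun v => H.le_of_opNorm_le this v
  have hM : mixedHessian f g Ξ x₀ μ₀ ξ₀ = D.comp (ContinuousLinearMap.inr ℝ _ _) :=
    (hasFDerivWithinAt_slice_right hD).fderivWithin (R.uniqueDiffOn ξ₀ hξ₀)
  have hG : activeParamDeriv g Ξ x₀ ξ₀ = (coordRestrict (fun i => g x₀ ξ₀ i = 0)).comp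
      (Q.comp (ContinuousLinearMap.inr ℝ _ _)) :=
    ((coordRestrict (fun i => g x₀ ξ₀ i = 0)).hasFDerivAt.comp_hasFDerivWithinAt ξ₀
      (hasFDerivWithinAt_slice_right hQ)).fderivWithin (R.uniqueDiffOn ξ₀ hξ₀)
  have hQx : ∀ v i, Q (v, 0) i = ⟪gradG g x₀ ξ₀ i, v⟫_ℝ := by
    intro v i
    have e1 := (EuclideanSpace.proj (𝕜 := ℝ) i).hasFDerivAt.comp x₀
      (hasFDerivAt_slice_left hQ hξ₀)
    have e2 := e1.unique (R.hasGradientAt_g hξ₀ x₀ i).hasFDerivAt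
    simpa using DFunLike.congr_fun e2 v
  have hgraph := R.tendsto_graph hs hξ₀
  have hDo := hgraph.eventually (hD.isLittleO.def (half_pos hε))
  have hQo := hgraph.eventually (hQ.isLittleO.def hε)
  have hGo : ∀ᶠ ξ in 𝓝[Ξ] ξ₀, ∑ i, ‖gradG g (xs ξ) ξ i - gradG g x₀ ξ₀ i‖ < ε := by
    have := tendsto_finsetSum Finset.univ fun i _ => R.tendsto_gradG hs hξ₀ i
    rw [Finset.sum_const_zero] at this
    exact this.eventually_lt_const hε
  -- By complementarity, a multiplier that stays positive keeps its constraint active at `ξ`.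
  have hpos : ∀ᶠ ξ in 𝓝[Ξ] ξ₀, ∀ i, 0 < μ₀ i → 0 < μs ξ i := by
    rw [eventually_all]
    intro i
    by_cases hi : 0 < μ₀ i
    · have h1 : Tendsto (fun ξ => μs ξ i) (𝓝[Ξ] ξ₀) (𝓝 (μ₀ i)) :=
        ((EuclideanSpace.proj (𝕜 := ℝ) i).continuous.tendsto _).comp
          (R.continuousOn_dual hs ξ₀ hξ₀)
      filter_upwards [h1.eventually_const_lt hi] with ξ h _ using h
    · exact Eventually.of_forall fun ξ h => absurd h hi
  filter_upwards [self_mem_nhdsWithin, R.eventually_inactive hs hξ₀, hpos, hDo, hQo, hGo]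
    with ξ hξ hin hpos hDo hQo hGo
  have h := hs ξ hξ
  set x := xs ξ with hx
  set μ := μs ξ with hμ
  have hpair : ‖((x, ξ) : Euc n × Euc r) - (x₀, ξ₀)‖ ≤ ‖x - x₀‖ + ‖ξ - ξ₀‖ := by
    rw [Prod.mk_sub_mk, Prod.norm_mk]
    exact max_le_add_of_nonneg (norm_nonneg _) (norm_nonneg _)
  have hsub : ∀ i, g x ξ i = 0 → g x₀ ξ₀ i = 0 := fun i hi => by
    by_contra h1
    exact absurd hi (hin i h1).ne
  have hsupp : ∀ i, ¬ g x ξ i = 0 → (μ - μ₀) i = 0 := fun i hi => by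
    have h1 := h.slack i (lt_of_le_of_ne (h.feasible i) hi)
    have h2 : μ₀ i = 0 := by
      by_contra h3
      exact absurd h1 (hpos i (lt_of_le_of_ne (h₀.nonneg i) (Ne.symm h3))).ne'
    simp [h1, h2]
  -- The index set is that of `ξ`, but the gradients are frozen at `ξ₀`; by `hsub` LICQ at `ξ₀`
  -- still applies to this subfamily.
  set T := rowCombination (fun i : Active g x ξ => gradG g x₀ ξ₀ i.1) with hT
  set ν := coordRestrict (fun i => g x ξ i = 0) (μ - μ₀) with hν
  have hTν : T ν = rowCombination (gradG g x₀ ξ₀) (μ - μ₀) :=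
    rowCombination_coordRestrict (p := fun i => g x ξ i = 0) _ hsupp
  have hνn : ‖ν‖ = ‖μ - μ₀‖ := norm_coordRestrict_of_support hsupp
  obtain ⟨k1, k2⟩ := saddle_system_bound H hα hB0 hsymm hlow hup T hω
    (R.norm_rowCombination_subtype_ge hξ₀ h₀.feasible hsub) (x := x - x₀) (ν := ν) rfl rfl
  set S := ‖x - x₀‖ + ‖μ - μ₀‖ + ‖ξ - ξ₀‖ with hS
  have ha : ‖H (x - x₀) + T ν‖ ≤ ‖mixedHessian f g Ξ x₀ μ₀ ξ₀‖ * ‖ξ - ξ₀‖ + ε * S := by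
    set e := gradL f g x μ₀ ξ - gradL f g x₀ μ₀ ξ₀ - D ((x, ξ) - (x₀, ξ₀)) with he
    have e0 : ‖e‖ ≤ ε * (‖x - x₀‖ + ‖ξ - ξ₀‖) :=
      hDo.trans (mul_le_mul (by linarith) hpair (norm_nonneg _) hε.le)
    have e1 : gradL f g x μ ξ = 0 := h.stationary
    have e2 : gradL f g x₀ μ₀ ξ₀ = 0 := h₀.stationary
    have e3 : gradL f g x μ ξ = gradL f g x μ₀ ξ + rowCombination (gradG g x ξ) (μ - μ₀) := by
      rw [R.gradL_eq hξ, R.gradL_eq hξ, map_sub]; abel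
    have e4 : D ((x, ξ) - (x₀, ξ₀)) = H (x - x₀) + mixedHessian f g Ξ x₀ μ₀ ξ₀ (ξ - ξ₀) := by
      rw [hM, hH]
      simp only [ContinuousLinearMap.comp_apply, ← map_add, ContinuousLinearMap.inl_apply,
        ContinuousLinearMap.inr_apply]
      simp
    have e5 : H (x - x₀) + T ν = -mixedHessian f g Ξ x₀ μ₀ ξ₀ (ξ - ξ₀) - e -
        ∑ i, (μ - μ₀) i • (gradG g x ξ i - gradG g x₀ ξ₀ i) := by
      rw [hTν, he, e4, e2]
      rw [e1] at e3
      simp only [smul_sub, Finset.sum_sub_distrib, ← rowCombination_apply]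
      rw [eq_neg_of_add_eq_zero_left e3.symm]
      abel
    -- This error is small relative to `‖μ - μ₀‖`, whose growth is not yet controlled; it is
    -- therefore kept in `S` and absorbed later.
    have e6 : ‖∑ i, (μ - μ₀) i • (gradG g x ξ i - gradG g x₀ ξ₀ i)‖ ≤ ε * ‖μ - μ₀‖ := by
      calc _ ≤ ∑ i, ‖(μ - μ₀) i • (gradG g x ξ i - gradG g x₀ ξ₀ i)‖ := norm_sum_le _ _
        _ ≤ ∑ i, ‖μ - μ₀‖ * ‖gradG g x ξ i - gradG g x₀ ξ₀ i‖ := by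
            refine Finset.sum_le_sum fun i _ => ?_
            rw [norm_smul]
            gcongr
            exact PiLp.norm_apply_le _ _
        _ = ‖μ - μ₀‖ * ∑ i, ‖gradG g x ξ i - gradG g x₀ ξ₀ i‖ := by rw [Finset.mul_sum]
        _ ≤ ‖μ - μ₀‖ * ε := by gcongr
        _ = _ := mul_comm _ _
    have e7 := (mixedHessian f g Ξ x₀ μ₀ ξ₀).le_opNorm (ξ - ξ₀)
    rw [e5]
    refine (norm_sub_le _ _).trans ?_
    have e8 := norm_sub_le (-mixedHessian f g Ξ x₀ μ₀ ξ₀ (ξ - ξ₀)) e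
    rw [norm_neg] at e8
    rw [hS]
    linarith
  have hb : ‖T.adjoint (x - x₀)‖ ≤ ‖activeParamDeriv g Ξ x₀ ξ₀‖ * ‖ξ - ξ₀‖ + ε * S := by
    set ρ := g x ξ - g x₀ ξ₀ - Q ((x, ξ) - (x₀, ξ₀)) with hρ
    have e0 : ‖ρ‖ ≤ ε * (‖x - x₀‖ + ‖ξ - ξ₀‖) :=
      hQo.trans (mul_le_mul_of_nonneg_left hpair hε.le)
    have e1 : T.adjoint (x - x₀) = -(coordRestrict (fun i => g x ξ i = 0) (Q (0, ξ - ξ₀)) +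
        coordRestrict (fun i => g x ξ i = 0) ρ) := by
      -- For `i` active at `ξ`, `g_i` vanishes at both solutions, so its linearisation expresses
      -- `⟪∇g_i, x - x₀⟫` through the parameter increment and the remainder.
      ext i
      have e2 : ρ i = g x ξ i - g x₀ ξ₀ i - Q ((x, ξ) - (x₀, ξ₀)) i := rfl
      have e3 : Q ((x, ξ) - (x₀, ξ₀)) = Q (x - x₀, 0) + Q (0, ξ - ξ₀) := by
        rw [← map_add]; simp
      rw [i.2, hsub i i.2, e3, PiLp.add_apply, hQx] at e2
      rw [hT, rowCombination_adjoint_apply, PiLp.neg_apply, PiLp.add_apply, coordRestrict_apply,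
        coordRestrict_apply, e2]
      ring
    have e4 : ‖coordRestrict (fun i => g x ξ i = 0) (Q (0, ξ - ξ₀))‖ ≤
        ‖activeParamDeriv g Ξ x₀ ξ₀‖ * ‖ξ - ξ₀‖ := by
      -- Enlarging the index set to the active set at `ξ₀` makes the bound independent of `ξ`.
      refine (norm_coordRestrict_le_of_imp hsub _).trans ?_
      have e5 := (activeParamDeriv g Ξ x₀ ξ₀).le_opNorm (ξ - ξ₀)
      have e6 : activeParamDeriv g Ξ x₀ ξ₀ (ξ - ξ₀) =
        coordRestrict (fun i => g x₀ ξ₀ i = 0) (Q (0, ξ - ξ₀)) := by rw [hG]; rfl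
      rwa [e6] at e5
    rw [e1, norm_neg]
    have e7 := norm_coordRestrict_le (fun i => g x ξ i = 0) ρ
    have e8 := mul_nonneg hε.le (norm_nonneg (μ - μ₀))
    refine (norm_add_le _ _).trans ?_
    rw [hS]
    linarith
  have hab : ‖H (x - x₀) + T ν‖ / α + ‖T.adjoint (x - x₀)‖ / ω ≤
      (‖mixedHessian f g Ξ x₀ μ₀ ξ₀‖ / α + ‖activeParamDeriv g Ξ x₀ ξ₀‖ / ω) * ‖ξ - ξ₀‖ +
        ε * (1 / α + 1 / ω) * S := by
    calc _ ≤ (‖mixedHessian f g Ξ x₀ μ₀ ξ₀‖ * ‖ξ - ξ₀‖ + ε * S) / α +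
          (‖activeParamDeriv g Ξ x₀ ξ₀‖ * ‖ξ - ξ₀‖ + ε * S) / ω := by gcongr
      _ = _ := by ring
  rw [hνn] at k2
  exact ⟨k1.trans (by gcongr), k2.trans (by gcongr)⟩

end IsRegular

end ParamProgram

/-! ### The Lipschitz estimates -/

/-- The multiplier constant in terms of square roots. -/
theorem rpow_three_halves_div {B α ω : ℝ} (hB : 0 ≤ B) :
    B ^ (3 / 2 : ℝ) / (α ^ (1 / 2 : ℝ) * ω) = B / ω * √(B / α) := by
  rw [Real.sqrt_div hB, Real.sqrt_eq_rpow, Real.sqrt_eq_rpow,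
    show (3 / 2 : ℝ) = 1 + 1 / 2 by norm_num, Real.rpow_add' hB (by norm_num), Real.rpow_one]
  ring

theorem mainTheorem2 {n m r : ℕ}
    (Ξ : Set (Euc r)) (hΞ : Convex ℝ Ξ) (hΞi : (interior Ξ).Nonempty)
    (f : Euc n → Euc r → ℝ) (g : Euc n → Euc r → Euc m)
    (hf : ContDiffOn ℝ 2 (fun p : Euc n × Euc r => f p.1 p.2) (univ ×ˢ Ξ))
    (hg : ContDiffOn ℝ 2 (fun p : Euc n × Euc r => g p.1 p.2) (univ ×ˢ Ξ))
    -- feasibility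
    (hfeas : ∀ ξ ∈ Ξ, (ParamProgram.feasible g ξ).Nonempty)
    -- convexity and smoothness in `x`
    (α : ℝ) (hα : 0 < α) (β : ℝ≥0) (l : Fin m → ℝ≥0)
    (hfconv : ∀ ξ ∈ Ξ, StrongConvexOn univ α (fun x => f x ξ))
    (hfLip : ∀ ξ ∈ Ξ, LipschitzWith β (gradient fun x => f x ξ))
    (hgconv : ∀ ξ ∈ Ξ, ∀ i, ConvexOn ℝ univ (fun x => g x ξ i))
    (hgLip : ∀ ξ ∈ Ξ, ∀ i, LipschitzWith (l i) (gradient fun x => g x ξ i))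
    -- uniform LICQ
    (ω : ℝ) (hω : 0 < ω) (hlicq : ParamProgram.UniformLICQ g Ξ ω)
    -- bounded multipliers
    (ζ : Fin m → ℝ) (hζ : ∀ i, 0 < ζ i)
    (hdual : ∀ ξ ∈ Ξ, ∀ x μ, ParamProgram.IsKKT f g ξ x μ → ∀ i, μ i ≤ ζ i) :
    ∃ (xs : Euc r → Euc n) (μs : Euc r → Euc m),
      (∀ ξ ∈ Ξ, ParamProgram.primalSolutions f g ξ = {xs ξ}) ∧
      (∀ ξ ∈ Ξ, ParamProgram.dualSolutions f g ξ = {μs ξ}) ∧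
      ∀ Lbar Gbar : ℝ,
        IsLUB ((fun ξ => ‖ParamProgram.mixedHessian f g Ξ (xs ξ) (μs ξ) ξ‖) '' Ξ) Lbar →
        IsLUB ((fun ξ => ‖ParamProgram.activeParamDeriv g Ξ (xs ξ) ξ‖) '' Ξ) Gbar →
        (∀ ξ ∈ Ξ, ∀ ξ' ∈ Ξ, ‖xs ξ' - xs ξ‖ ≤
          (Real.sqrt ((β + ∑ i, ζ i * l i) / α) * (Lbar / α + Gbar / ω)) * ‖ξ' - ξ‖) ∧
        (∀ ξ ∈ Ξ, ∀ ξ' ∈ Ξ, ‖μs ξ' - μs ξ‖ ≤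
          ((β + ∑ i, ζ i * l i) ^ (3 / 2 : ℝ) / (α ^ (1 / 2 : ℝ) * ω)
            * (Lbar / α + Gbar / ω)) * ‖ξ' - ξ‖) := by
  have R : ParamProgram.IsRegular Ξ f g α β l ω ζ :=
    ⟨hΞ, hΞi, hf, hg, hfeas, hα, hfconv, hfLip, hgconv, hgLip, hω, hlicq, hζ, hdual⟩
  obtain ⟨xs, μs, hx, hμ, hs⟩ := R.exists_solutionMaps
  refine ⟨xs, μs, hx, hμ, fun Lbar Gbar hL hG => ?_⟩
  set B : ℝ := β + ∑ i, ζ i * l i with hB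
  have hB0 : 0 ≤ B :=
    add_nonneg β.2 (Finset.sum_nonneg fun i _ => mul_nonneg (hζ i).le (l i).2)
  rw [rpow_three_halves_div hB0]
  have key : ∀ ξ₀ ∈ Ξ, ∀ δ > 0, ∀ᶠ ξ in 𝓝[Ξ] ξ₀,
      ‖xs ξ - xs ξ₀‖ ≤ (√(B / α) * (Lbar / α + Gbar / ω) + δ) * ‖ξ - ξ₀‖ ∧
      ‖μs ξ - μs ξ₀‖ ≤ (B / ω * √(B / α) * (Lbar / α + Gbar / ω) + δ) * ‖ξ - ξ₀‖ := by
    intro ξ₀ hξ₀ δ hδ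
    have hL₀ := hL.1 (mem_image_of_mem _ hξ₀)
    have hG₀ := hG.1 (mem_image_of_mem _ hξ₀)
    have h := eventually_le_of_forall_eventually_le_add (by positivity) (by positivity)
      (by positivity) (by positivity) (fun ξ => norm_nonneg (ξ - ξ₀))
      (fun ξ => norm_nonneg (xs ξ - xs ξ₀)) (fun ξ => norm_nonneg (μs ξ - μs ξ₀))
      (fun ε hε => R.eventually_norm_le hs hξ₀ hB hε) hδ
    filter_upwards [h] with ξ hξ
    -- The derivative norms at `ξ₀` are replaced by their suprema, which makes the growth rate
    -- uniform over `Ξ`.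
    exact ⟨hξ.1.trans (by gcongr), hξ.2.trans (by gcongr)⟩
  constructor
  · intro ξ hξ ξ' hξ'
    exact norm_image_sub_le_of_eventually_le hΞ (R.continuousOn_primal hs)
      (fun ξ₀ hξ₀ δ hδ => (key ξ₀ hξ₀ δ hδ).mono fun _ h => h.1) hξ hξ'
  · intro ξ hξ ξ' hξ'
    exact norm_image_sub_le_of_eventually_le hΞ (R.continuousOn_dual hs)
      (fun ξ₀ hξ₀ δ hδ => (key ξ₀ hξ₀ δ hδ).mono fun _ h => h.2) hξ hξ'
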